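/- Let $S>0$, let $M=(m_{ij})$ be a real $2\times 2$ matrix with $\det M=1$, and let $q\in L^2[-S,S]$ be real valued. Consider the Neumann–Neumann problem $$-y''+q(x)y=\lambda y\quad\text{on }[-S,0)\cup(0,S],\qquad \begin{pmatrix}y(0^+)\\ y'(0^+)\end{pmatrix}=M\begin{pmatrix}y(0^-)\\ y'(0^-)\end{pmatrix},\qquad y'(-S)=0=y'(S),$$ where $y,y'$ are absolutely continuous on each of the two halves of the interval up to the one-sided endpoint $0$, and the equation holds almost everywhere. Its spectrum is the set of $\lambda\in\mathbb C$ for which it has a solution that is not identically zero. The norming constant of an eigenvalue $\lambda_n$ is $a_n=\int_{-S}^{S}w(x,\lambda_n)^2\,dx$, where $w(\cdot,\lambda)$ is the solution of the equation and the transfer condition with $w(-S,\lambda)=1$, $w'(-S,\lambda)=0$. Then the spectrum and the corresponding norming constants, together with $M$, determine $q$ uniquely: if $q_1,q_2\in L^2[-S,S]$ are real valued, and the Neumann–Neumann problems for $q_1$ and for $q_2$, with the same $S$ and the same $M$, have the same spectrum and the same norming constant at each eigenvalue, then $q_1=q_2$ almost everywhere on $[-S,S]$. -/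

import Mathlib

open Set MeasureTheory

namespace TransferSL

/-- `f` is a (Carathéodory) solution of `-f'' + q f = z f` on the compact interval `[a, b]`, with
derivative `df`.  The second condition says that `df` is absolutely continuous on `[a, b]` with
`df' = (q - z) f` almost everywhere (for `q ∈ L²` the integrand is integrable, since `f` is
continuous).  At the endpoints the derivative is one-sided. -/
structure IsSolutionOn (q : ℝ → ℝ) (z : ℂ) (a b : ℝ) (f df : ℝ → ℂ) : Prop where
  hasDeriv : ∀ x ∈ Icc a b, HasDerivWithinAt f (df x) (Icc a b) x
  eq_integral : ∀ x ∈ Icc a b, df x = df a + ∫ t in a..x, ((q t : ℂ) - z) * f t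

/-- `y` (with derivative `dy`) is a solution of `-y'' + q y = z y` on `[-S, 0) ∪ (0, S]` satisfying
the transfer condition `(y(0⁺), y'(0⁺)) = M (y(0⁻), y'(0⁻))`.

Here `l, dl` are the continuous extensions of `y, y'` from `[-S, 0)` to `[-S, 0]` and `r, dr` those
from `(0, S]` to `[0, S]`, so that `l 0 = y(0⁻)`, `dl 0 = y'(0⁻)`, `r 0 = y(0⁺)`, `dr 0 = y'(0⁺)`.
The values of `y` and `dy` at `0` itself are irrelevant. -/
def IsTransferSolution (S : ℝ) (q : ℝ → ℝ) (M : Matrix (Fin 2) (Fin 2) ℝ) (z : ℂ)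
    (y dy : ℝ → ℂ) : Prop :=
  ∃ l dl r dr : ℝ → ℂ,
    IsSolutionOn q z (-S) 0 l dl ∧ IsSolutionOn q z 0 S r dr ∧
    EqOn y l (Ico (-S) 0) ∧ EqOn dy dl (Ico (-S) 0) ∧
    EqOn y r (Ioc 0 S) ∧ EqOn dy dr (Ioc 0 S) ∧
    r 0 = M 0 0 * l 0 + M 0 1 * dl 0 ∧
    dr 0 = M 1 0 * l 0 + M 1 1 * dl 0

/-- The spectrum of the Neumann–Neumann problem on `[-S, S]`: the set of those `z ∈ ℂ` for which
there is a solution, not identically zero, of the equation with the transfer condition that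
satisfies `y'(-S) = 0 = y'(S)`. -/
def neumannSpectrum (S : ℝ) (q : ℝ → ℝ) (M : Matrix (Fin 2) (Fin 2) ℝ) : Set ℂ :=
  {z | ∃ y dy : ℝ → ℂ, IsTransferSolution S q M z y dy ∧ dy (-S) = 0 ∧ dy S = 0 ∧
    ∃ x ∈ Icc (-S) S \ {0}, y x ≠ 0}

/-- `a` is the norming constant `∫_{-S}^{S} w(x, z)² dx`, where `w(·, z)` is the solution with
the transfer condition and with the initial values `w(-S, z) = 1`, `w'(-S, z) = 0`. -/
def IsNormingConstant (S : ℝ) (q : ℝ → ℝ) (M : Matrix (Fin 2) (Fin 2) ℝ) (z a : ℂ) : Prop :=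
  ∃ w dw : ℝ → ℂ, IsTransferSolution S q M z w dw ∧ w (-S) = 1 ∧ dw (-S) = 0 ∧
    a = ∫ x in (-S)..S, w x ^ 2

end TransferSL

/-! Let φ and θ be the transfer solutions with Cauchy data (1, 0) and (0, 1) at -S, and let m =
θ'(S)/φ'(S) be the Weyl function, so that ψ = mφ - θ satisfies ψ'(-S) = -1 and ψ'(S) = 0. The
eigenvalues are the zeros of φ'(S, ·). They are real, and Lagrange's identity shows that m has
residue -1/a at an eigenvalue with norming constant a (`tendsto_sub_mul_weyl`). Equal spectral data
therefore make m₁ - m₂ extend to an entire function h. Since det M = 1, the transfer condition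
preserves Wronskians and Im m = Im z · ‖ψ‖². This gives m = O(|z|²/|Im z|), hence linear growth of
h. No eigenvalue asymptotics enter, so the shape of M plays no role.

The inverse step is `borg_marchenko`, used on each half. Let c and s have data (1, 0) and (0, 1) at
the left endpoint of the half. For fixed x, the function h c₁c₂ + c₁s₂ - c₂s₁ is entire in z and
bounded by exp(B√|z|). Off the real axis it equals c₂ψ₁ - c₁ψ₂ with ψ = mc - s, which is
O(|z|^(-1/2)) on the imaginary axis because ψ decays as fast as c grows. Phragmén–Lindelöf and
Liouville force it to vanish. At the left endpoint this reads h = 0. Then s₁/c₁ = s₂/c₂;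
differentiating, c₁² = c₂², so c₁ = c₂ and the potentials agree.

On [-S, 0] this applies to m₁ and m₂. It also makes ψ₁ and ψ₂ agree there, so M carries them to the
same data at 0⁺. Hence both problems have the same right-hand Weyl function -ψ(0⁺)/ψ'(0⁺), and the
theorem applies again on [0, S] with h = 0. -/

namespace TransferSL

/-! ### Absolutely continuous functions and the product rule -/

/-- `F` is the absolutely continuous function with derivative `f` on `[a, b]`. -/
structure IsPrimitiveOn (a b : ℝ) (F f : ℝ → ℂ) : Prop where
  integrable : IntervalIntegrable f volume a b
  eq_integral : ∀ x ∈ Icc a b, F x = F a + ∫ t in a..x, f t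

/-- Increments of the integral are dominated by those of the real function ∫‖f‖, so absolute
continuity carries over from the real case. -/
theorem absolutelyContinuousOnInterval_integral {a b : ℝ} {f : ℝ → ℂ}
    (hf : IntervalIntegrable f volume a b) (C : ℂ) :
    AbsolutelyContinuousOnInterval (fun x ↦ C + ∫ t in a..x, f t) a b := by
  have hN : AbsolutelyContinuousOnInterval (fun x ↦ ∫ t in a..x, ‖f t‖) a b :=
    hf.norm.absolutelyContinuousOnInterval_intervalIntegral (by simp)
  have key : ∀ x ∈ uIcc a b, ∀ y ∈ uIcc a b, dist (C + ∫ t in a..x, f t) (C + ∫ t in a..y, f t) ≤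
      dist (∫ t in a..x, ‖f t‖) (∫ t in a..y, ‖f t‖) := by
    intro x hx y hy
    have h1 : ∀ u ∈ uIcc a b, IntervalIntegrable f volume a u := fun u hu ↦
      hf.mono_set (uIcc_subset_uIcc left_mem_uIcc hu)
    rw [dist_add_left, dist_eq_norm, dist_eq_norm,
      intervalIntegral.integral_interval_sub_left (h1 x hx) (h1 y hy),
      intervalIntegral.integral_interval_sub_left (h1 x hx).norm (h1 y hy).norm, Real.norm_eq_abs]
    exact intervalIntegral.norm_integral_le_abs_integral_norm
  rw [absolutelyContinuousOnInterval_iff] at hN ⊢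
  intro ε hε
  obtain ⟨δ, hδ, h⟩ := hN ε hε
  refine ⟨δ, hδ, fun E hE hlt ↦ lt_of_le_of_lt (Finset.sum_le_sum fun i hi ↦ ?_) (h E hE hlt)⟩
  have := hE.1 i hi
  exact key _ this.1 _ this.2

theorem IsPrimitiveOn.continuousOn {a b : ℝ} (hab : a ≤ b) {F f : ℝ → ℂ}
    (h : IsPrimitiveOn a b F f) : ContinuousOn F (Icc a b) := by
  have := (absolutelyContinuousOnInterval_integral h.integrable (F a)).continuousOn
  rw [uIcc_of_le hab] at this
  exact this.congr h.eq_integral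

/-- Product rule for absolutely continuous functions. -/
theorem IsPrimitiveOn.mul {a b : ℝ} (hab : a ≤ b) {F f G g : ℝ → ℂ}
    (hF : IsPrimitiveOn a b F f) (hG : IsPrimitiveOn a b G g) :
    IsPrimitiveOn a b (fun x ↦ F x * G x) (fun x ↦ f x * G x + F x * g x) := by
  have hFc := hF.continuousOn hab
  have hGc := hG.continuousOn hab
  rw [← uIcc_of_le hab] at hFc hGc
  have hint : IntervalIntegrable (fun x ↦ f x * G x + F x * g x) volume a b :=
    (hF.integrable.mul_continuousOn hGc).add (hG.integrable.continuousOn_mul hFc)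
  refine ⟨hint, fun x hx ↦ ?_⟩
  -- The product minus its candidate primitive is absolutely continuous with derivative zero a.e.,
  -- hence constant.
  have hac := (((absolutelyContinuousOnInterval_integral hF.integrable (F a)).smul
    (absolutelyContinuousOnInterval_integral hG.integrable (G a))).sub
    (absolutelyContinuousOnInterval_integral hint 0))
  obtain ⟨C, hC⟩ := hac.const_of_ae_hasDerivAt_zero (by
    filter_upwards [hF.integrable.ae_hasDerivAt_integral, hG.integrable.ae_hasDerivAt_integral,
      hint.ae_hasDerivAt_integral] with t h1 h2 h3 ht
    have e1 := (h1 ht a left_mem_uIcc).const_add (F a)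
    have e2 := (h2 ht a left_mem_uIcc).const_add (G a)
    have e3 := (h3 ht a left_mem_uIcc).const_add 0
    have ht' := ht
    rw [uIcc_of_le hab] at ht'
    convert! (e1.mul e2).sub e3 using 1
    rw [← hF.eq_integral t ht', ← hG.eq_integral t ht']
    ring)
  have h1 := hC a left_mem_uIcc
  have h2 := hC x (by rwa [uIcc_of_le hab])
  simp only [Pi.sub_apply, smul_eq_mul, Pi.mul_apply, intervalIntegral.integral_same, add_zero,
    sub_zero, zero_add] at h1 h2
  rw [← hF.eq_integral x hx, ← hG.eq_integral x hx, ← h1] at h2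
  linear_combination h2

theorem isPrimitiveOn_of_hasDerivWithinAt {a b : ℝ} (hab : a ≤ b) {F f : ℝ → ℂ}
    (h : ∀ x ∈ Icc a b, HasDerivWithinAt F (f x) (Icc a b) x) (hf : ContinuousOn f (Icc a b)) :
    IsPrimitiveOn a b F f := by
  refine ⟨ContinuousOn.intervalIntegrable (by rwa [uIcc_of_le hab]), fun x hx ↦ ?_⟩
  rw [intervalIntegral.integral_eq_sub_of_hasDerivAt_of_le hx.1
    (fun t ht ↦ ((h t ⟨ht.1, ht.2.trans hx.2⟩).continuousWithinAt.mono
      (Icc_subset_Icc_right hx.2)))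
    (fun t ht ↦ (h t ⟨ht.1.le, ht.2.le.trans hx.2⟩).hasDerivAt
      (Icc_mem_nhds ht.1 (ht.2.trans_le hx.2)))
    (ContinuousOn.intervalIntegrable ?_)]
  · ring
  · rw [uIcc_of_le hx.1]
    exact hf.mono (Icc_subset_Icc_right hx.2)

/-! ### Lagrange's identity and operations on solutions -/

section Solution

variable {q : ℝ → ℝ} {a b : ℝ} {z ζ : ℂ} {f df g dg : ℝ → ℂ}

theorem intervalIntegrable_coeff (hq : IntervalIntegrable q volume a b) (z : ℂ) :
    IntervalIntegrable (fun t ↦ (q t : ℂ) - z) volume a b :=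
  IntervalIntegrable.sub ⟨hq.1.ofReal, hq.2.ofReal⟩ intervalIntegrable_const

theorem IsSolutionOn.continuousOn (h : IsSolutionOn q z a b f df) : ContinuousOn f (Icc a b) :=
  fun x hx ↦ (h.hasDeriv x hx).continuousWithinAt

theorem IsSolutionOn.isPrimitiveOn_deriv (hab : a ≤ b) (hq : IntervalIntegrable q volume a b)
    (h : IsSolutionOn q z a b f df) : IsPrimitiveOn a b df fun t ↦ ((q t : ℂ) - z) * f t :=
  ⟨(intervalIntegrable_coeff hq z).mul_continuousOn (by
    rw [uIcc_of_le hab]; exact h.continuousOn), h.eq_integral⟩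

theorem IsSolutionOn.continuousOn_deriv (hab : a ≤ b) (hq : IntervalIntegrable q volume a b)
    (h : IsSolutionOn q z a b f df) : ContinuousOn df (Icc a b) :=
  (h.isPrimitiveOn_deriv hab hq).continuousOn hab

theorem IsSolutionOn.isPrimitiveOn (hab : a ≤ b) (hq : IntervalIntegrable q volume a b)
    (h : IsSolutionOn q z a b f df) : IsPrimitiveOn a b f df :=
  isPrimitiveOn_of_hasDerivWithinAt hab h.hasDeriv (h.continuousOn_deriv hab hq)

/-- Lagrange's identity. -/
theorem IsSolutionOn.wronskian (hab : a ≤ b) (hq : IntervalIntegrable q volume a b)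
    (hf : IsSolutionOn q z a b f df) (hg : IsSolutionOn q ζ a b g dg) {x : ℝ} (hx : x ∈ Icc a b) :
    f x * dg x - df x * g x = f a * dg a - df a * g a + (z - ζ) * ∫ t in a..x, f t * g t := by
  have h1 := (hf.isPrimitiveOn hab hq).mul hab (hg.isPrimitiveOn_deriv hab hq)
  have h2 := (hf.isPrimitiveOn_deriv hab hq).mul hab (hg.isPrimitiveOn hab hq)
  have e1 := h1.eq_integral x hx
  have e2 := h2.eq_integral x hx
  have hsub : uIcc a x ⊆ uIcc a b := by
    rw [uIcc_of_le hab, uIcc_of_le hx.1]; exact Icc_subset_Icc_right hx.2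
  have e3 := intervalIntegral.integral_sub (h1.integrable.mono_set hsub)
    (h2.integrable.mono_set hsub)
  rw [e1, e2, ← intervalIntegral.integral_const_mul]
  have this : ∀ t, (df t * dg t + f t * (((q t : ℂ) - ζ) * g t)) -
    (((q t : ℂ) - z) * f t * g t + df t * dg t) = (z - ζ) * (f t * g t) := fun t ↦ by ring
  simp only [this] at e3
  rw [e3]
  ring

theorem IsSolutionOn.linear_combination (hab : a ≤ b) (hq : IntervalIntegrable q volume a b)
    (hf : IsSolutionOn q z a b f df) (hg : IsSolutionOn q z a b g dg) (α β : ℂ) :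
    IsSolutionOn q z a b (fun x ↦ α * f x + β * g x) (fun x ↦ α * df x + β * dg x) := by
  refine ⟨fun x hx ↦ ((hf.hasDeriv x hx).const_mul α).add ((hg.hasDeriv x hx).const_mul β),
    fun x hx ↦ ?_⟩
  have hsub : uIcc a x ⊆ uIcc a b := by
    rw [uIcc_of_le hab, uIcc_of_le hx.1]; exact Icc_subset_Icc_right hx.2
  have h1 := ((hf.isPrimitiveOn_deriv hab hq).integrable.mono_set hsub).const_mul α
  have h2 := ((hg.isPrimitiveOn_deriv hab hq).integrable.mono_set hsub).const_mul β
  have e := intervalIntegral.integral_add h1 h2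
  have : ∀ t, ((q t : ℂ) - z) * (α * f t + β * g t) =
    α * (((q t : ℂ) - z) * f t) + β * (((q t : ℂ) - z) * g t) := fun t ↦ by ring
  simp only [this]
  rw [e, intervalIntegral.integral_const_mul, intervalIntegral.integral_const_mul,
    hf.eq_integral x hx, hg.eq_integral x hx]
  ring

theorem IsSolutionOn.conj (h : IsSolutionOn q z a b f df) :
    IsSolutionOn q (star z) a b (fun x ↦ star (f x)) (fun x ↦ star (df x)) := by
  refine ⟨fun x hx ↦ (h.hasDeriv x hx).star, fun x hx ↦ ?_⟩
  rw [h.eq_integral x hx, star_add]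
  congr 1
  have := intervalIntegral.intervalIntegral_conj (𝕜 := ℂ) (f := fun t ↦ ((q t : ℂ) - z) * f t) (a := a) (b := x) (μ := volume)
  simpa using! this.symm

end Solution

/-! ### Volterra operators: existence of solutions, analytic in the spectral parameter -/

theorem isUnit_one_sub_of_conj {R : Type*} [Ring R] {x u v : R} (huv : u * v = 1) (hvu : v * u = 1)
    (h : IsUnit (1 - v * x * u)) : IsUnit (1 - x) := by
  have e : 1 - x = u * (1 - v * x * u) * v := by
    have : u * (1 - v * x * u) * v = u * v - (u * v) * x * (u * v) := by noncomm_ring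
    rw [this, huv, one_mul, mul_one]
  rw [e]
  exact ((isUnit_iff_exists.2 ⟨_, huv, hvu⟩).mul h).mul (isUnit_iff_exists.2 ⟨_, hvu, huv⟩)

/-- Inversion is holomorphic on the units of a Banach algebra, so the fixed point inherits
analyticity in z from the operator pencil. -/
theorem exists_differentiable_fixedPoint {E : Type*} [NormedAddCommGroup E] [NormedSpace ℂ E]
    [CompleteSpace E] (V Q : E →L[ℂ] E) (h : ∀ z : ℂ, IsUnit (1 - V * (Q - z • V))) (y : E) :
    ∃ F : ℂ → E, Differentiable ℂ F ∧ (Differentiable ℂ fun z ↦ (Q - z • V) (F z)) ∧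
      ∀ z, F z = y + V ((Q - z • V) (F z)) := by
  have hlin : Differentiable ℂ fun z : ℂ ↦ Q - z • V := by fun_prop
  have hd : Differentiable ℂ fun z : ℂ ↦ (Ring.inverse (1 - V * (Q - z • V)) : E →L[ℂ] E) y := by
    intro z
    have h1 : DifferentiableAt ℂ (fun z : ℂ ↦ 1 - V * (Q - z • V)) z :=
      ((hlin z).const_mul V).const_sub 1
    exact ((differentiableAt_inverse (𝕜 := ℂ) (h z)).comp z h1).clm_apply
      (differentiableAt_const _)
  refine ⟨_, hd, fun z ↦ (hlin z).clm_apply (hd z), fun z ↦ ?_⟩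
  have h1 : (1 - V * (Q - z • V)) ((Ring.inverse (1 - V * (Q - z • V)) : E →L[ℂ] E) y) = y :=
    congrArg (fun L : E →L[ℂ] E ↦ L y) (Ring.mul_inverse_cancel _ (h z))
  nth_rewrite 2 [← h1]
  simp

section Volterra

variable {a b : ℝ}

theorem intervalIntegrable_mul_IccExtend (hab : a ≤ b) {p : ℝ → ℂ}
    (hp : IntervalIntegrable p volume a b) (F : C(Icc a b, ℂ)) {x : ℝ} (hx : x ∈ Icc a b) :
    IntervalIntegrable (fun t ↦ p t * IccExtend hab F t) volume a x := by
  have hsub : uIcc a x ⊆ uIcc a b := by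
    rw [uIcc_of_le hab, uIcc_of_le hx.1]; exact Icc_subset_Icc_right hx.2
  exact (hp.mono_set hsub).mul_continuousOn (F.continuous.Icc_extend' (h := hab)).continuousOn

theorem norm_integral_mul_IccExtend_le (hab : a ≤ b) {p : ℝ → ℂ}
    (hp : IntervalIntegrable p volume a b) (F : C(Icc a b, ℂ)) {x : ℝ} (hx : x ∈ Icc a b) {C : ℝ}
    (hC : ∀ t ∈ Icc a x, ‖IccExtend hab F t‖ ≤ C) :
    ‖∫ t in a..x, p t * IccExtend hab F t‖ ≤ (∫ t in a..b, ‖p t‖) * C := by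
  have hC0 : 0 ≤ C := (norm_nonneg _).trans (hC a (left_mem_Icc.2 hx.1))
  have hsub : uIcc a x ⊆ uIcc a b := by
    rw [uIcc_of_le hab, uIcc_of_le hx.1]; exact Icc_subset_Icc_right hx.2
  calc ‖∫ t in a..x, p t * IccExtend hab F t‖
      ≤ ∫ t in a..x, ‖p t‖ * C := by
        refine intervalIntegral.norm_integral_le_of_norm_le hx.1
          (Filter.Eventually.of_forall fun t ht ↦ ?_) ((hp.mono_set hsub).norm.mul_const C)
        rw [norm_mul]
        exact mul_le_mul_of_nonneg_left (hC t (Ioc_subset_Icc_self ht)) (norm_nonneg _)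
    _ = (∫ t in a..x, ‖p t‖) * C := intervalIntegral.integral_mul_const _ _
    _ ≤ _ := mul_le_mul_of_nonneg_right (intervalIntegral.integral_mono_interval le_rfl hx.1 hx.2
        (Filter.Eventually.of_forall fun t ↦ norm_nonneg _) hp.norm) hC0

/-- The Volterra operator `F ↦ ∫_a^x p F` on continuous functions. -/
noncomputable def volterra (hab : a ≤ b) (p : ℝ → ℂ) (hp : IntervalIntegrable p volume a b) :
    C(Icc a b, ℂ) →L[ℂ] C(Icc a b, ℂ) :=
  LinearMap.mkContinuous
    { toFun := fun F ↦ ⟨fun x ↦ ∫ t in a..(x : ℝ), p t * IccExtend hab F t, by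
        have h := intervalIntegral.continuousOn_primitive_interval'
          (intervalIntegrable_mul_IccExtend hab hp F (right_mem_Icc.2 hab)) left_mem_uIcc
        rw [uIcc_of_le hab] at h
        exact continuousOn_iff_continuous_domRestrict.1 h⟩
      map_add' := fun F G ↦ by
        ext x
        have := intervalIntegral.integral_add (intervalIntegrable_mul_IccExtend hab hp F x.2)
          (intervalIntegrable_mul_IccExtend hab hp G x.2)
        simpa [IccExtend, mul_add] using this
      map_smul' := fun c F ↦ by
        ext x
        simp [IccExtend, mul_left_comm] }
    (∫ t in a..b, ‖p t‖) (fun F ↦ by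
      rw [ContinuousMap.norm_le _ (mul_nonneg
        (intervalIntegral.integral_nonneg hab fun t _ ↦ norm_nonneg _) (norm_nonneg _))]
      exact fun x ↦ norm_integral_mul_IccExtend_le hab hp F x.2 fun t _ ↦ F.norm_coe_le_norm _)

theorem volterra_apply (hab : a ≤ b) {p : ℝ → ℂ} (hp : IntervalIntegrable p volume a b)
    (F : C(Icc a b, ℂ)) (x : Icc a b) :
    volterra hab p hp F x = ∫ t in a..(x : ℝ), p t * IccExtend hab F t := rfl

theorem volterra_sub_const (hab : a ≤ b) {p : ℝ → ℂ} (hp : IntervalIntegrable p volume a b)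
    (z : ℂ) : volterra hab (fun t ↦ p t - z) (hp.sub intervalIntegrable_const) =
      volterra hab p hp - z • volterra hab (fun _ ↦ 1) intervalIntegrable_const := by
  ext F x
  have h1 := intervalIntegrable_mul_IccExtend hab hp F x.2
  have h2 := intervalIntegrable_mul_IccExtend hab
    (intervalIntegrable_const (μ := volume) (c := (1 : ℂ))) F x.2
  have := intervalIntegral.integral_sub h1 (h2.const_mul z)
  rw [intervalIntegral.integral_const_mul] at this
  simp only [_root_.sub_apply, _root_.smul_apply, ContinuousMap.sub_apply,
    ContinuousMap.smul_apply, volterra_apply, smul_eq_mul]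
  rw [← this]
  simp only [sub_mul, one_mul]

/-- Conjugation by multiplication with exp(c(x - a)), i.e. passage to a weighted sup norm, shrinks
the norm of the Volterra product to at most N/c. The choice c = N + 1 makes this less than 1, and a
Neumann series applies. -/
theorem isUnit_one_sub_volterra_mul (hab : a ≤ b) {p : ℝ → ℂ}
    (hp : IntervalIntegrable p volume a b) :
    IsUnit (1 - volterra hab (fun _ ↦ 1) intervalIntegrable_const * volterra hab p hp) := by
  set V := volterra hab (fun _ ↦ 1) intervalIntegrable_const with hV
  set P := volterra hab p hp with hP
  set N := ∫ t in a..b, ‖p t‖ with hN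
  have hN0 : 0 ≤ N := intervalIntegral.integral_nonneg hab fun t _ ↦ norm_nonneg _
  set c : ℝ := N + 1 with hc
  have hc0 : 0 < c := by positivity
  let w : ℝ → C(Icc a b, ℂ) := fun s ↦ ⟨fun x ↦ ((Real.exp (s * (x - a)) : ℝ) : ℂ), by fun_prop⟩
  have hw : ∀ s, w s * w (-s) = 1 := fun s ↦ by
    ext x
    simp [w, ← Complex.exp_add]
  let U : ℝ → (C(Icc a b, ℂ) →L[ℂ] C(Icc a b, ℂ)) := fun s ↦ ContinuousLinearMap.mul ℂ _ (w s)
  have hU : ∀ s, U s * U (-s) = 1 := fun s ↦ by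
    ext F x
    have := congrArg (fun G : C(Icc a b, ℂ) ↦ G x * F x) (hw s)
    simpa [U, mul_assoc] using this
  have hsmall : ‖U (-c) * (V * P) * U c‖ ≤ N / c := by
    refine ContinuousLinearMap.opNorm_le_bound _ (by positivity) fun F ↦ ?_
    rw [ContinuousMap.norm_le _ (by positivity)]
    intro x
    have hin : ∀ s ∈ Icc a (x : ℝ), ‖IccExtend hab (P (U c F)) s‖ ≤
        N * (Real.exp (c * (s - a)) * ‖F‖) := by
      intro s hs
      have hs' : s ∈ Icc a b := ⟨hs.1, hs.2.trans x.2.2⟩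
      rw [IccExtend_of_mem hab _ hs', hP, volterra_apply]
      refine norm_integral_mul_IccExtend_le hab hp _ hs' fun t ht ↦ ?_
      rw [IccExtend_of_mem hab _ ⟨ht.1, ht.2.trans hs'.2⟩]
      simp only [U, w, ContinuousLinearMap.mul_apply', ContinuousMap.mul_apply,
        ContinuousMap.coe_mk, norm_mul, Complex.norm_real, Real.norm_eq_abs, Real.abs_exp]
      exact mul_le_mul (Real.exp_le_exp.2 (mul_le_mul_of_nonneg_left (by linarith [ht.2]) hc0.le))
        (F.norm_coe_le_norm _) (norm_nonneg _) (Real.exp_pos _).le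
    have hout : ‖V (P (U c F)) x‖ ≤ N * ‖F‖ * (Real.exp (c * (x - a)) / c) := by
      rw [hV, volterra_apply]
      have hder : ∀ s ∈ uIcc a (x : ℝ), HasDerivAt (fun s ↦ N * ‖F‖ * (Real.exp (c * (s - a)) / c))
          (N * (Real.exp (c * (s - a)) * ‖F‖)) s := by
        intro s _
        have h0 : HasDerivAt (fun s : ℝ ↦ c * (s - a)) c s := by
          simpa using ((hasDerivAt_id s).sub_const a).const_mul c
        convert! (h0.exp.div_const c).const_mul (N * ‖F‖) using 1
        field_simp
      calc _ ≤ ∫ s in a..(x : ℝ), N * (Real.exp (c * (s - a)) * ‖F‖) := by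
            refine intervalIntegral.norm_integral_le_of_norm_le x.2.1
              (Filter.Eventually.of_forall fun s hs ↦ ?_)
              (Continuous.intervalIntegrable (by fun_prop) _ _)
            rw [one_mul]
            exact hin s (Ioc_subset_Icc_self hs)
        _ = N * ‖F‖ * (Real.exp (c * (x - a)) / c) - N * ‖F‖ * (Real.exp (c * (a - a)) / c) :=
            intervalIntegral.integral_eq_sub_of_hasDerivAt hder
              (Continuous.intervalIntegrable (by fun_prop) _ _)
        _ ≤ _ := sub_le_self _ (by positivity)
    change ‖w (-c) x * V (P (U c F)) x‖ ≤ _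
    rw [norm_mul]
    have hwn : ‖w (-c) x‖ = Real.exp (-(c * (x - a))) := by
      simp only [w, ContinuousMap.coe_mk, Complex.norm_real, Real.norm_eq_abs, Real.abs_exp, neg_mul]
    rw [hwn]
    calc _ ≤ Real.exp (-(c * (x - a))) * (N * ‖F‖ * (Real.exp (c * (x - a)) / c)) :=
          mul_le_mul_of_nonneg_left hout (Real.exp_pos _).le
      _ = (Real.exp (-(c * (x - a))) * Real.exp (c * (x - a))) * (N / c * ‖F‖) := by ring
      _ = _ := by rw [← Real.exp_add]; simp
  have hlt : ‖U (-c) * (V * P) * U c‖ < 1 :=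
    hsmall.trans_lt (by rw [div_lt_one hc0]; linarith)
  have h1 := isUnit_one_sub_of_norm_lt_one (R := C(Icc a b, ℂ) →L[ℂ] C(Icc a b, ℂ)) hlt
  exact isUnit_one_sub_of_conj (hU c) (by simpa using hU (-c)) h1

end Volterra

/-- A family of solutions with fixed initial data at `a`, depending analytically on the spectral
parameter. -/
structure IsAnalyticSolution (q : ℝ → ℝ) (a b : ℝ) (α β : ℂ) (f df : ℂ → ℝ → ℂ) : Prop where
  isSolutionOn : ∀ z, IsSolutionOn q z a b (f z) (df z)
  initial : ∀ z, f z a = α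
  initial_deriv : ∀ z, df z a = β
  continuous : Continuous (Function.uncurry f)
  differentiable : ∀ x ∈ Icc a b, Differentiable ℂ fun z ↦ f z x
  differentiable_deriv : ∀ x ∈ Icc a b, Differentiable ℂ fun z ↦ df z x

/-- The equations f = α + ∫ f' and f' = β + ∫ (q - z) f combine into F = y + V(Q - zV)F with y = α +
β(x - a). `IccExtend` makes the result jointly continuous on all of ℂ × ℝ. -/
theorem exists_isAnalyticSolution {a b : ℝ} (hab : a ≤ b) {q : ℝ → ℝ}
    (hq : IntervalIntegrable q volume a b) (α β : ℂ) :
    ∃ f df : ℂ → ℝ → ℂ, IsAnalyticSolution q a b α β f df := by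
  have hqc : IntervalIntegrable (fun t ↦ (q t : ℂ)) volume a b := ⟨hq.1.ofReal, hq.2.ofReal⟩
  set V := volterra hab (fun _ ↦ 1) intervalIntegrable_const with hV
  set Q := volterra hab _ hqc with hQ
  let y : C(Icc a b, ℂ) := ⟨fun x ↦ α + β * ((x : ℝ) - a), by fun_prop⟩
  have hunit : ∀ z : ℂ, IsUnit (1 - V * (Q - z • V)) := fun z ↦ by
    rw [hQ, hV, ← volterra_sub_const]
    exact isUnit_one_sub_volterra_mul hab _
  obtain ⟨F, hFd, hQFd, hfix⟩ := exists_differentiable_fixedPoint V Q hunit y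
  let D : ℂ → C(Icc a b, ℂ) := fun z ↦ ContinuousMap.const _ β + (Q - z • V) (F z)
  have hDd : Differentiable ℂ D := by
    exact hQFd.const_add _
  have heval : ∀ (G : ℂ → C(Icc a b, ℂ)), Differentiable ℂ G → ∀ x ∈ Icc a b,
      Differentiable ℂ fun z ↦ IccExtend hab (G z) x := by
    intro G hG x hx z
    have := (ContinuousMap.evalCLM ℂ (⟨x, hx⟩ : Icc a b)).differentiableAt.comp z (hG z)
    simpa only [IccExtend_of_mem hab _ hx] using! this
  have hDval : ∀ z, ∀ x ∈ Icc a b, IccExtend hab (D z) x =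
      β + ∫ t in a..x, ((q t : ℂ) - z) * IccExtend hab (F z) t := by
    intro z x hx
    rw [IccExtend_of_mem hab _ hx]
    simp only [D, hQ, hV]
    rw [← volterra_sub_const]
    rfl
  have hFval : ∀ z, ∀ x ∈ Icc a b, IccExtend hab (F z) x =
      α + ∫ t in a..x, IccExtend hab (D z) t := by
    intro z x hx
    have e : ∀ t, IccExtend hab (D z) t = β + 1 * IccExtend hab ((Q - z • V) (F z)) t := fun t ↦ by
      simp [D, IccExtend]
    simp only [e]
    rw [intervalIntegral.integral_add intervalIntegrable_const
      (intervalIntegrable_mul_IccExtend hab intervalIntegrable_const _ hx),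
      IccExtend_of_mem hab _ hx]
    conv_lhs => rw [hfix z]
    generalize (Q - z • V) (F z) = G
    simp only [ContinuousMap.add_apply, hV, volterra_apply, intervalIntegral.integral_const]
    simp [y]
    ring
  refine ⟨fun z ↦ IccExtend hab (F z), fun z ↦ IccExtend hab (D z), fun z ↦ ⟨fun x hx ↦ ?_,
    fun x hx ↦ ?_⟩, fun z ↦ ?_, fun z ↦ ?_, ?_, heval F hFd, heval D hDd⟩
  · have hDc : Continuous (IccExtend hab (D z)) := (D z).continuous.Icc_extend'
    have := (hDc.integral_hasStrictDerivAt a x).hasDerivAt.const_add α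
    exact this.hasDerivWithinAt.congr (fun t ht ↦ hFval z t ht) (hFval z x hx)
  · rw [hDval z x hx, hDval z a (left_mem_Icc.2 hab)]
    simp
  · rw [hFval z a (left_mem_Icc.2 hab)]; simp
  · rw [hDval z a (left_mem_Icc.2 hab)]; simp
  · have hFc := hFd.continuous
    have : Continuous fun p : ℂ × ℝ ↦ F p.1 (projIcc a b hab p.2) := by
      have h2 : Continuous fun p : ℂ × ℝ ↦ projIcc a b hab p.2 :=
        continuous_projIcc.comp continuous_snd
      fun_prop
    exact this

/-! ### Exponential bounds for solutions at large spectral parameter -/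

theorem norm_exp_I_mul_le {w : ℂ} (hw : 0 ≤ w.im) :
    ‖Complex.exp (w * Complex.I)‖ ≤ Real.exp w.im ∧
      ‖Complex.exp (-w * Complex.I)‖ = Real.exp w.im := by
  simp [Complex.norm_exp, hw]

theorem norm_cos_le_exp_im {w : ℂ} (hw : 0 ≤ w.im) : ‖Complex.cos w‖ ≤ Real.exp w.im := by
  obtain ⟨h1, h2⟩ := norm_exp_I_mul_le hw
  rw [Complex.cos, norm_div, Complex.norm_ofNat, div_le_iff₀ two_pos]
  linarith [norm_add_le (Complex.exp (w * Complex.I)) (Complex.exp (-w * Complex.I))]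

theorem norm_sin_le_exp_im {w : ℂ} (hw : 0 ≤ w.im) : ‖Complex.sin w‖ ≤ Real.exp w.im := by
  obtain ⟨h1, h2⟩ := norm_exp_I_mul_le hw
  rw [Complex.sin, norm_div, norm_mul, Complex.norm_I, mul_one, Complex.norm_ofNat,
    div_le_iff₀ two_pos]
  linarith [norm_sub_le (Complex.exp (-w * Complex.I)) (Complex.exp (w * Complex.I))]

theorem le_norm_cos {w : ℂ} (hw : 1 ≤ w.im) : 3 / 8 * Real.exp w.im ≤ ‖Complex.cos w‖ := by
  have h1 : ‖Complex.exp (w * Complex.I)‖ = Real.exp (-w.im) := by simp [Complex.norm_exp]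
  have h2 := (norm_exp_I_mul_le (zero_le_one.trans hw)).2
  have h3 : Real.exp (-w.im) ≤ 1 / 4 * Real.exp w.im := by
    have h4 : (4 : ℝ) ≤ Real.exp w.im * Real.exp w.im := by
      have : 2 ≤ Real.exp w.im := by linarith [Real.add_one_le_exp w.im]
      nlinarith
    rw [Real.exp_neg, inv_le_iff_one_le_mul₀ (Real.exp_pos _)]
    linarith
  rw [Complex.cos, norm_div, Complex.norm_ofNat, le_div_iff₀ two_pos, add_comm]
  have := norm_sub_le_norm_add (Complex.exp (-w * Complex.I)) (Complex.exp (w * Complex.I))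
  linarith

section Asymptotics

variable {q : ℝ → ℝ} {a b : ℝ} {z k : ℂ} {f df : ℝ → ℂ}

/-- The Volterra integral equation of a solution, with the free equation as reference. -/
theorem IsSolutionOn.eq_cos_add_sin (hab : a ≤ b) (hq : IntervalIntegrable q volume a b)
    (hf : IsSolutionOn q z a b f df) (hk : k ≠ 0) (hkz : k ^ 2 = z) {x : ℝ} (hx : x ∈ Icc a b) :
    f x = f a * Complex.cos (k * ↑(x - a)) + df a * (Complex.sin (k * ↑(x - a)) / k) +
      ∫ t in a..x, Complex.sin (k * ↑(x - t)) / k * (q t * f t) := by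
  have hlin : ∀ t : ℝ, HasDerivAt (fun t : ℝ ↦ k * ((x - t : ℝ) : ℂ)) (-k) t := fun t ↦ by
    have h1 : HasDerivAt (fun t : ℝ ↦ x - t) (-1) t := by
      simpa using (hasDerivAt_id t).const_sub x
    simpa using h1.ofReal_comp.const_mul k
  -- Variation of constants: the t-derivative of sin(k(x-t))/k · f' + cos(k(x-t)) · f is
  -- sin(k(x-t))/k · q f.
  have hs : IsPrimitiveOn a b (fun t ↦ Complex.sin (k * ↑(x - t)) / k)
      (fun t ↦ -Complex.cos (k * ↑(x - t))) := by
    refine isPrimitiveOn_of_hasDerivWithinAt hab (fun t _ ↦ HasDerivAt.hasDerivWithinAt ?_)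
      (by fun_prop)
    convert! (((Complex.hasDerivAt_sin _).comp t (hlin t)).div_const k) using 1
    field_simp
  have hc : IsPrimitiveOn a b (fun t ↦ Complex.cos (k * ↑(x - t)))
      (fun t ↦ k * Complex.sin (k * ↑(x - t))) := by
    refine isPrimitiveOn_of_hasDerivWithinAt hab (fun t _ ↦ HasDerivAt.hasDerivWithinAt ?_)
      (by fun_prop)
    convert! ((Complex.hasDerivAt_cos _).comp t (hlin t)) using 1
    ring
  have h1 := hs.mul hab (hf.isPrimitiveOn_deriv hab hq)
  have h2 := hc.mul hab (hf.isPrimitiveOn hab hq)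
  have hsub : uIcc a x ⊆ uIcc a b := by
    rw [uIcc_of_le hab, uIcc_of_le hx.1]; exact Icc_subset_Icc_right hx.2
  have e3 := intervalIntegral.integral_add (h1.integrable.mono_set hsub)
    (h2.integrable.mono_set hsub)
  have e1 := h1.eq_integral x hx
  have e2 := h2.eq_integral x hx
  have this : ∀ t, -Complex.cos (k * ↑(x - t)) * df t +
      Complex.sin (k * ↑(x - t)) / k * (((q t : ℂ) - z) * f t) +
      (k * Complex.sin (k * ↑(x - t)) * f t + Complex.cos (k * ↑(x - t)) * df t) =
      Complex.sin (k * ↑(x - t)) / k * (q t * f t) := fun t ↦ by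
    rw [← hkz]
    field_simp
    ring
  simp only [this] at e3
  simp only [sub_self, Complex.ofReal_zero, mul_zero, Complex.sin_zero, zero_div, zero_mul,
    Complex.cos_zero, one_mul] at e1 e2
  rw [e3, e2]
  linear_combination e1

theorem IsSolutionOn.norm_sub_le (hab : a ≤ b) (hq : IntervalIntegrable q volume a b)
    (hf : IsSolutionOn q z a b f df) (hk : k ≠ 0) (hkz : k ^ 2 = z) (hk0 : 0 ≤ k.im) {N : ℝ}
    (hN : ∀ t ∈ Icc a b, ‖f t‖ ≤ N * Real.exp (k.im * (t - a))) {x : ℝ} (hx : x ∈ Icc a b) :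
    ‖f x - (f a * Complex.cos (k * ↑(x - a)) + df a * (Complex.sin (k * ↑(x - a)) / k))‖ ≤
      Real.exp (k.im * (x - a)) * (N / ‖k‖ * ∫ t in a..b, |q t|) := by
  have hN0 : 0 ≤ N := by
    simpa using (norm_nonneg _).trans (hN a (left_mem_Icc.2 hab))
  have hsub : uIcc a x ⊆ uIcc a b := by
    rw [uIcc_of_le hab, uIcc_of_le hx.1]; exact Icc_subset_Icc_right hx.2
  rw [hf.eq_cos_add_sin hab hq hk hkz hx, add_sub_cancel_left]
  calc _ ≤ ∫ t in a..x, Real.exp (k.im * (x - a)) * (N / ‖k‖) * |q t| := by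
        refine intervalIntegral.norm_integral_le_of_norm_le hx.1
          (Filter.Eventually.of_forall fun t ht ↦ ?_) ((hq.mono_set hsub).abs.const_mul _)
        have him : (k * ((x - t : ℝ) : ℂ)).im = k.im * (x - t) := by
          rw [Complex.im_mul_ofReal]
        have h1 : ‖Complex.sin (k * ↑(x - t))‖ ≤ Real.exp (k.im * (x - t)) := by
          rw [← him]
          exact norm_sin_le_exp_im (by rw [him]; exact mul_nonneg hk0 (by linarith [ht.2]))
        have h2 := hN t ⟨ht.1.le, ht.2.trans hx.2⟩
        rw [norm_mul, norm_div, norm_mul, Complex.norm_real, Real.norm_eq_abs]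
        calc _ ≤ Real.exp (k.im * (x - t)) / ‖k‖ *
              (|q t| * (N * Real.exp (k.im * (t - a)))) := by gcongr
          _ = Real.exp (k.im * (x - t)) * Real.exp (k.im * (t - a)) * (N / ‖k‖) * |q t| := by ring
          _ = _ := by
            rw [← Real.exp_add]
            congr 3
            ring_nf
    _ = Real.exp (k.im * (x - a)) * (N / ‖k‖) * ∫ t in a..x, |q t| :=
        intervalIntegral.integral_const_mul _ _
    _ ≤ _ := by
        rw [mul_assoc]
        gcongr
        exact intervalIntegral.integral_mono_interval le_rfl hx.1 hx.2
          (Filter.Eventually.of_forall fun t ↦ abs_nonneg _) hq.abs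

/-- Let N be the maximum of |f| exp(-Im k (x - a)). At the maximum point the Volterra equation gives
N ≤ |f(a)| + |f'(a)| + N/2, because ‖k‖ ≥ 2∫|q|. -/
theorem IsSolutionOn.norm_le (hab : a ≤ b) (hq : IntervalIntegrable q volume a b)
    (hf : IsSolutionOn q z a b f df) (hkz : k ^ 2 = z) (hk0 : 0 ≤ k.im) (hk1 : 1 ≤ ‖k‖)
    (hk2 : 2 * (∫ t in a..b, |q t|) ≤ ‖k‖) {x : ℝ} (hx : x ∈ Icc a b) :
    ‖f x‖ ≤ 2 * (‖f a‖ + ‖df a‖) * Real.exp (k.im * (x - a)) := by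
  have hkpos : 0 < ‖k‖ := zero_lt_one.trans_le hk1
  have hk : k ≠ 0 := norm_pos_iff.1 hkpos
  have hcont : ContinuousOn (fun x ↦ ‖f x‖ * Real.exp (-(k.im * (x - a)))) (Icc a b) :=
    hf.continuousOn.norm.mul (by fun_prop)
  obtain ⟨y, hy, hmax⟩ := isCompact_Icc.exists_isMaxOn ⟨a, left_mem_Icc.2 hab⟩ hcont
  set N := ‖f y‖ * Real.exp (-(k.im * (y - a))) with hNdef
  have hN : ∀ t ∈ Icc a b, ‖f t‖ ≤ N * Real.exp (k.im * (t - a)) := fun t ht ↦ by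
    have h : ‖f t‖ * Real.exp (-(k.im * (t - a))) ≤ N := hmax ht
    rwa [Real.exp_neg, ← div_eq_mul_inv, div_le_iff₀ (Real.exp_pos _)] at h
  have hN0 : 0 ≤ N := by positivity
  have him : (k * ((y - a : ℝ) : ℂ)).im = k.im * (y - a) := by rw [Complex.im_mul_ofReal]
  have him0 : 0 ≤ (k * ((y - a : ℝ) : ℂ)).im := by
    rw [him]; exact mul_nonneg hk0 (by linarith [hy.1])
  have hc := norm_cos_le_exp_im him0
  have hs := norm_sin_le_exp_im him0
  rw [him] at hc hs
  have hmain : ‖f a * Complex.cos (k * ↑(y - a)) + df a * (Complex.sin (k * ↑(y - a)) / k)‖ ≤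
      (‖f a‖ + ‖df a‖) * Real.exp (k.im * (y - a)) := by
    refine (norm_add_le _ _).trans ?_
    rw [norm_mul, norm_mul, norm_div, add_mul]
    gcongr
    exact (div_le_self (norm_nonneg _) hk1).trans hs
  have herr := hf.norm_sub_le hab hq hk hkz hk0 hN hy
  have hhalf : N / ‖k‖ * (∫ t in a..b, |q t|) ≤ N / 2 := by
    rw [div_mul_eq_mul_div, div_le_div_iff₀ hkpos two_pos]
    nlinarith
  have hfy : ‖f y‖ ≤ (‖f a‖ + ‖df a‖ + N / 2) * Real.exp (k.im * (y - a)) := by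
    have h1 := norm_le_norm_add_norm_sub' (f y)
      (f a * Complex.cos (k * ↑(y - a)) + df a * (Complex.sin (k * ↑(y - a)) / k))
    have h2 : Real.exp (k.im * (y - a)) * (N / ‖k‖ * ∫ t in a..b, |q t|) ≤
        Real.exp (k.im * (y - a)) * (N / 2) := by gcongr
    linarith
  have hNle : N ≤ ‖f a‖ + ‖df a‖ + N / 2 := by
    have h := mul_le_mul_of_nonneg_right hfy (Real.exp_pos (-(k.im * (y - a)))).le
    rwa [← hNdef, mul_assoc, ← Real.exp_add, add_neg_cancel, Real.exp_zero, mul_one] at h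
  refine (hN x hx).trans ?_
  gcongr
  linarith

/-- The leading term cos has size at least 3/8 of the exponential, and the remainder at most 1/8. -/
theorem IsSolutionOn.le_norm (hab : a ≤ b) (hq : IntervalIntegrable q volume a b)
    (hf : IsSolutionOn q z a b f df) (hfa : f a = 1) (hdfa : df a = 0) (hkz : k ^ 2 = z)
    (hk0 : 0 ≤ k.im) (hk1 : 1 ≤ ‖k‖) (hk2 : 16 * (∫ t in a..b, |q t|) ≤ ‖k‖) {x : ℝ}
    (hx : x ∈ Icc a b) (hkx : 1 ≤ k.im * (x - a)) :
    Real.exp (k.im * (x - a)) / 4 ≤ ‖f x‖ := by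
  have hkpos : 0 < ‖k‖ := zero_lt_one.trans_le hk1
  have hk : k ≠ 0 := norm_pos_iff.1 hkpos
  have hQ : 0 ≤ ∫ t in a..b, |q t| := intervalIntegral.integral_nonneg hab fun t _ ↦ abs_nonneg _
  have hN : ∀ t ∈ Icc a b, ‖f t‖ ≤ 2 * Real.exp (k.im * (t - a)) := fun t ht ↦ by
    simpa [hfa, hdfa] using hf.norm_le hab hq hkz hk0 hk1 (by linarith) ht
  have herr := hf.norm_sub_le hab hq hk hkz hk0 hN hx
  have h8 : 2 / ‖k‖ * (∫ t in a..b, |q t|) ≤ 1 / 8 := by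
    rw [div_mul_eq_mul_div, div_le_div_iff₀ hkpos (by norm_num)]
    linarith
  have him : (k * ((x - a : ℝ) : ℂ)).im = k.im * (x - a) := by rw [Complex.im_mul_ofReal]
  have hc := le_norm_cos (w := k * ((x - a : ℝ) : ℂ)) (by rwa [him])
  rw [him] at hc
  rw [hfa, hdfa, one_mul, zero_mul, add_zero, norm_sub_rev] at herr
  have h1 := norm_le_norm_add_norm_sub' (Complex.cos (k * ↑(x - a))) (f x)
  have h2 : Real.exp (k.im * (x - a)) * (2 / ‖k‖ * ∫ t in a..b, |q t|) ≤
      Real.exp (k.im * (x - a)) * (1 / 8) := by gcongr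
  linarith

/-- Only the right half of [a, x] is used, where Im k (t - a) ≥ 1 and the pointwise lower bound
holds. The contribution of the midpoint is at most half of that of x, since exp(Im k (x - a)) ≥ 2.
-/
theorem IsSolutionOn.le_integral_norm_sq (hab : a ≤ b) (hq : IntervalIntegrable q volume a b)
    (hf : IsSolutionOn q z a b f df) (hfa : f a = 1) (hdfa : df a = 0) (hkz : k ^ 2 = z)
    (hk0 : 0 < k.im) (hk1 : 1 ≤ ‖k‖) (hk2 : 16 * (∫ t in a..b, |q t|) ≤ ‖k‖) {x : ℝ}
    (hx : x ∈ Icc a b) (hkx : 2 ≤ k.im * (x - a)) :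
    Real.exp (2 * (k.im * (x - a))) / (64 * k.im) ≤ ∫ t in a..x, ‖f t‖ ^ 2 := by
  set c := (a + x) / 2 with hc
  have hac : a ≤ c := by rw [hc]; linarith [hx.1]
  have hcx : c ≤ x := by rw [hc]; linarith [hx.1]
  have hcont : ContinuousOn (fun t ↦ ‖f t‖ ^ 2) (Icc a x) :=
    (hf.continuousOn.mono (Icc_subset_Icc_right hx.2)).norm.pow 2
  have hint : IntervalIntegrable (fun t ↦ ‖f t‖ ^ 2) volume a x :=
    ContinuousOn.intervalIntegrable (by rwa [uIcc_of_le hx.1])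
  have hint' : IntervalIntegrable (fun t ↦ ‖f t‖ ^ 2) volume c x :=
    ContinuousOn.intervalIntegrable (by
      rw [uIcc_of_le hcx]; exact hcont.mono (Icc_subset_Icc_left hac))
  have hder : ∀ s ∈ uIcc c x, HasDerivAt (fun s ↦ Real.exp (2 * (k.im * (s - a))) / (32 * k.im))
      (Real.exp (2 * (k.im * (s - a))) / 16) s := by
    intro s _
    have h0 : HasDerivAt (fun s : ℝ ↦ 2 * (k.im * (s - a))) (2 * k.im) s := by
      simpa using (((hasDerivAt_id s).sub_const a).const_mul k.im).const_mul 2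
    convert! h0.exp.div_const (32 * k.im) using 1
    field_simp
    norm_num
  calc Real.exp (2 * (k.im * (x - a))) / (64 * k.im)
      ≤ Real.exp (2 * (k.im * (x - a))) / (32 * k.im) -
          Real.exp (2 * (k.im * (c - a))) / (32 * k.im) := by
        have e1 : 2 * (k.im * (x - a)) = k.im * (x - a) + k.im * (x - a) := by ring
        have e2 : 2 * (k.im * (c - a)) = k.im * (x - a) := by rw [hc]; ring
        have h2 : 2 ≤ Real.exp (k.im * (x - a)) := by
          linarith [Real.add_one_le_exp (k.im * (x - a))]
        rw [e1, e2, Real.exp_add, ← sub_div, div_le_div_iff₀ (by positivity) (by positivity)]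
        have : 0 ≤ 32 * k.im * (Real.exp (k.im * (x - a)) * (Real.exp (k.im * (x - a)) - 2)) :=
          by have := sub_nonneg.2 h2; positivity
        linarith
    _ = ∫ s in c..x, Real.exp (2 * (k.im * (s - a))) / 16 :=
        (intervalIntegral.integral_eq_sub_of_hasDerivAt hder
          (Continuous.intervalIntegrable (by fun_prop) _ _)).symm
    _ ≤ ∫ t in c..x, ‖f t‖ ^ 2 := by
        refine intervalIntegral.integral_mono_on hcx
          (Continuous.intervalIntegrable (by fun_prop) _ _) hint' fun t ht ↦ ?_
        have h1 : 1 ≤ k.im * (t - a) := by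
          have : k.im * (c - a) ≤ k.im * (t - a) := by gcongr; exact ht.1
          have e2 : 2 * (k.im * (c - a)) = k.im * (x - a) := by rw [hc]; ring
          linarith
        have h2 := hf.le_norm hab hq hfa hdfa hkz hk0.le hk1 hk2
          ⟨hac.trans ht.1, ht.2.trans hx.2⟩ h1
        calc _ = (Real.exp (k.im * (t - a)) / 4) ^ 2 := by
              rw [div_pow, ← Real.exp_nat_mul]; norm_num
          _ ≤ _ := by gcongr
    _ ≤ _ := intervalIntegral.integral_mono_interval hac hcx le_rfl
        (Filter.Eventually.of_forall fun t ↦ by positivity) hint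

end Asymptotics

/-! ### Growth of entire functions and removable singularities -/

section ComplexAnalysis

open Filter Topology

/-- An entire function of order `1/2` which tends to zero along the imaginary axis vanishes. -/
theorem eq_zero_of_norm_le_exp_sqrt {E : ℂ → ℂ} (hE : Differentiable ℂ E) {A B K R : ℝ}
    (hR : 1 ≤ R) (hA : ∀ z, R ≤ ‖z‖ → ‖E z‖ ≤ A * Real.exp (B * √‖z‖))
    (hK : ∀ z : ℂ, z.re = 0 → R ≤ ‖z‖ → ‖E z‖ ≤ K / √‖z‖) (z : ℂ) : E z = 0 := by
  have hK0 : 0 ≤ K := by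
    have h := (norm_nonneg _).trans (hK (Complex.I * R) (by simp) (by simp [abs_of_nonneg (zero_le_one.trans hR)]))
    have h1 : 0 < √‖Complex.I * (R : ℂ)‖ := Real.sqrt_pos.2 (by
      simp; linarith)
    by_contra hneg
    exact absurd h (not_le.2 (div_neg_of_neg_of_pos (not_le.1 hneg) h1))
  obtain ⟨C₀, hC₀⟩ := (isCompact_closedBall (0 : ℂ) R).exists_bound_of_continuousOn
    hE.continuous.continuousOn
  set C := max C₀ K with hC
  have haxis : ∀ z : ℂ, z.re = 0 → ‖E z‖ ≤ C := by
    intro z hz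
    rcases le_total R ‖z‖ with h | h
    · refine (hK z hz h).trans (le_trans (div_le_self hK0 ?_) (le_max_right _ _))
      rw [Real.one_le_sqrt]
      exact hR.trans h
    · exact (hC₀ z (by simpa using h)).trans (le_max_left _ _)
  -- With z = I w², both axes of the w-plane go to the imaginary z-axis and the growth becomes
  -- exponential of order 1, below the critical order 2 of a quadrant.
  let F : ℂ → ℂ := fun w ↦ E (Complex.I * w ^ 2)
  have hF : Differentiable ℂ F := hE.comp (by fun_prop)
  have hO : ∀ s : Set ℂ, F =O[Bornology.cobounded ℂ ⊓ 𝓟 s]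
      fun z ↦ Real.exp (B * ‖z‖ ^ (1 : ℝ)) := by
    intro s
    refine (Asymptotics.IsBigO.of_bound A ?_).mono inf_le_left
    filter_upwards [Bornology.eventually_ne_cobounded (0 : ℂ),
      (tendsto_norm_cobounded_atTop (E := ℂ)).eventually_ge_atTop R] with w _ hw
    have h1 : ‖Complex.I * w ^ 2‖ = ‖w‖ ^ 2 := by simp
    have h2 := hA (Complex.I * w ^ 2) (by rw [h1]; nlinarith)
    rw [h1, Real.sqrt_sq (norm_nonneg _)] at h2
    simpa using h2
  have hre : ∀ x : ℝ, ‖F x‖ ≤ C := fun x ↦ haxis _ (by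
    simp [pow_two])
  have him : ∀ x : ℝ, ‖F (x * Complex.I)‖ ≤ C := fun x ↦ haxis _ (by
    simp [pow_two])
  have hbound : ∀ w, ‖F w‖ ≤ C := by
    intro w
    rcases le_total 0 w.re with h1 | h1 <;> rcases le_total 0 w.im with h2 | h2
    · exact PhragmenLindelof.quadrant_I hF.diffContOnCl ⟨1, one_lt_two, B, hO _⟩
        (fun x _ ↦ hre x) (fun x _ ↦ him x) h1 h2
    · exact PhragmenLindelof.quadrant_IV hF.diffContOnCl ⟨1, one_lt_two, B, hO _⟩
        (fun x _ ↦ hre x) (fun x _ ↦ him x) h1 h2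
    · exact PhragmenLindelof.quadrant_II hF.diffContOnCl ⟨1, one_lt_two, B, hO _⟩
        (fun x _ ↦ hre x) (fun x _ ↦ him x) h1 h2
    · exact PhragmenLindelof.quadrant_III hF.diffContOnCl ⟨1, one_lt_two, B, hO _⟩
        (fun x _ ↦ hre x) (fun x _ ↦ him x) h1 h2
  have hEb : ∀ z, ‖E z‖ ≤ C := by
    intro z
    obtain ⟨w, hw⟩ := IsAlgClosed.exists_pow_nat_eq (-Complex.I * z) two_pos
    have h := hbound w
    have h1 : Complex.I * w ^ 2 = z := by
      rw [hw, ← mul_assoc, mul_neg, Complex.I_mul_I, neg_neg, one_mul]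
    simpa only [F, h1] using h
  have hconst : ∀ w, E z = E w := fun w ↦ hE.apply_eq_apply_of_bounded
    (isBounded_iff_forall_norm_le.2 ⟨C, by rintro _ ⟨x, rfl⟩; exact hEb x⟩) z w
  have hle : ∀ᶠ t : ℝ in atTop, ‖E z‖ ≤ K / √t := by
    filter_upwards [eventually_ge_atTop R] with t ht
    have ht0 : 0 ≤ t := by linarith
    rw [hconst (Complex.I * t)]
    have h := hK (Complex.I * t) (by simp) (by simpa [abs_of_nonneg ht0] using ht)
    simpa [abs_of_nonneg ht0] using h
  have hlim : Tendsto (fun t : ℝ ↦ K / √t) atTop (𝓝 0) :=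
    Real.tendsto_sqrt_atTop.const_div_atTop K
  exact norm_le_zero_iff.1 (ge_of_tendsto hlim hle)

/-- An entire function which is `O(|z|² / |Im z|)` grows at most linearly. -/
theorem exists_norm_le_mul_norm {h : ℂ → ℂ} (hh : Differentiable ℂ h) {C : ℝ}
    (hC : ∀ z, ‖h z‖ * |z.im| ≤ C * (1 + ‖z‖) ^ 2) :
    ∃ C', ∀ z, 1 ≤ ‖z‖ → ‖h z‖ ≤ C' * ‖z‖ := by
  have hC0 : 0 ≤ C := by simpa using hC 0
  refine ⟨12 * C, fun z hz ↦ ?_⟩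
  set r := ‖z‖ with hr
  have hr0 : 0 < r := by linarith
  set R : ℝ := 2 * r with hR
  -- On |w| = R the factor w² - R² has modulus 2R|Im w|, which cancels the weight |Im w| in the
  -- hypothesis. The maximum principle then brings the bound inside, where the factor is at least
  -- 3r².
  have hd : Differentiable ℂ fun w ↦ h w * (w ^ 2 - R ^ 2) := by fun_prop
  have hfr : ∀ w ∈ frontier (Metric.ball (0 : ℂ) R), ‖h w * (w ^ 2 - R ^ 2)‖ ≤
      2 * R * (C * (1 + R) ^ 2) := by
    intro w hw
    rw [frontier_ball _ (by positivity), mem_sphere_zero_iff_norm] at hw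
    have h1 : (R : ℂ) ^ 2 = w * star w := by
      rw [← hw]
      simp [Complex.mul_conj, Complex.normSq_eq_norm_sq]
    have h2 : w ^ 2 - (R : ℂ) ^ 2 = w * (2 * w.im * Complex.I) := by
      rw [h1]
      have : w - star w = 2 * w.im * Complex.I := by
        simpa using Complex.sub_conj w
      rw [← this]; ring
    have h3 : ‖w ^ 2 - (R : ℂ) ^ 2‖ = 2 * R * |w.im| := by
      rw [h2]
      simp [hw]
      ring
    rw [norm_mul, h3]
    have := hC w
    rw [hw] at this
    nlinarith [mul_le_mul_of_nonneg_left this (by positivity : (0 : ℝ) ≤ 2 * R)]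
  have hmain := Complex.norm_le_of_forall_mem_frontier_norm_le Metric.isBounded_ball
    hd.diffContOnCl hfr (z := z) (subset_closure (by simp [hR, ← hr]; linarith))
  have hlow : 3 * r ^ 2 ≤ ‖z ^ 2 - (R : ℂ) ^ 2‖ := by
    have h1 := norm_sub_norm_le ((R : ℂ) ^ 2) (z ^ 2)
    rw [norm_sub_rev] at h1
    have h2 : ‖(R : ℂ) ^ 2‖ = 4 * r ^ 2 := by
      rw [norm_pow, Complex.norm_real, Real.norm_eq_abs, abs_of_nonneg (by positivity), hR]; ring
    rw [h2, norm_pow, ← hr] at h1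
    linarith
  rw [norm_mul] at hmain
  have h5 : ‖h z‖ * (3 * r ^ 2) ≤ 36 * C * r ^ 3 := by
    refine (mul_le_mul_of_nonneg_left hlow (norm_nonneg _)).trans (hmain.trans ?_)
    have h6 : (1 + R) ^ 2 ≤ 9 * r ^ 2 := by
      rw [hR]; nlinarith
    calc 2 * R * (C * (1 + R) ^ 2) ≤ 2 * R * (C * (9 * r ^ 2)) := by gcongr
      _ = 36 * C * r ^ 3 := by rw [hR]; ring
  have h7 : 0 < 3 * r ^ 2 := by positivity
  refine le_of_mul_le_mul_right ?_ h7
  calc _ ≤ _ := h5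
    _ = _ := by ring

/-- A meromorphic function with at most removable singularities extends to an entire function. -/
theorem exists_differentiable_extension {h₀ : ℂ → ℂ} (hm : ∀ z, MeromorphicAt h₀ z)
    (h : ∀ z₀, Tendsto (fun z ↦ (z - z₀) * h₀ z) (𝓝[≠] z₀) (𝓝 0)) :
    ∃ h₁ : ℂ → ℂ, Differentiable ℂ h₁ ∧ ∀ z, AnalyticAt ℂ h₀ z → h₁ z = h₀ z := by
  have hmo : MeromorphicOn h₀ univ := fun z _ ↦ hm z
  refine ⟨toMeromorphicNFOn h₀ univ, fun z ↦ ?_, fun z hz ↦ ?_⟩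
  · have hnf := meromorphicNFOn_toMeromorphicNFOn (f := h₀) (U := univ) (mem_univ z)
    refine (hnf.meromorphicOrderAt_nonneg_iff_analyticAt.1 ?_).differentiableAt
    rw [meromorphicOrderAt_toMeromorphicNFOn hmo (mem_univ z)]
    have hlin : MeromorphicAt (fun w : ℂ ↦ w - z) z := by fun_prop
    -- The order of (w - z)h₀ is positive, so the order of h₀ exceeds -1 and is therefore
    -- nonnegative.
    have h1 := (tendsto_zero_iff_meromorphicOrderAt_pos (hlin.mul (hm z))).1 (h z)
    rw [meromorphicOrderAt_mul hlin (hm z)] at h1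
    have h2 : meromorphicOrderAt (fun w : ℂ ↦ w - z) z = 1 := meromorphicOrderAt_id_sub_const
    rw [h2] at h1
    revert h1
    cases meromorphicOrderAt h₀ z with
    | top => simp
    | coe n =>
      intro h1
      norm_cast at h1 ⊢
      omega
  · rw [toMeromorphicNFOn_eq_toMeromorphicNFAt hmo (mem_univ z),
      toMeromorphicNFAt_eq_self.2 hz.meromorphicNFAt]

end ComplexAnalysis

/-! ### Imaginary-part inequalities and recovery of the potential from a solution -/

theorem exists_sq_eq_im_nonneg (z : ℂ) : ∃ k : ℂ, k ^ 2 = z ∧ 0 ≤ k.im ∧ ‖k‖ = √‖z‖ := by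
  obtain ⟨k, hk⟩ := IsAlgClosed.exists_pow_nat_eq z two_pos
  have hn : ‖k‖ = √‖z‖ := by rw [← hk, norm_pow, Real.sqrt_sq (norm_nonneg _)]
  rcases le_total 0 k.im with h | h
  · exact ⟨k, hk, h, hn⟩
  · exact ⟨-k, by rw [neg_sq, hk], by simpa using h, by rw [norm_neg, hn]⟩

theorem norm_le_two_mul_im {k : ℂ} (h : (k ^ 2).re = 0) (hk : 0 ≤ k.im) : ‖k‖ ≤ 2 * k.im := by
  have h1 : k.re * k.re - k.im * k.im = 0 := by simpa [pow_two] using h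
  have h2 : ‖k‖ ^ 2 = k.re * k.re + k.im * k.im := by
    rw [← Complex.normSq_eq_norm_sq, Complex.normSq_apply]
  exact abs_le_of_sq_le_sq' (by nlinarith) (by positivity) |>.2

/-- The Wronskian gives conj(φψ) = φ'φ̄|ψ|² - ψ'ψ̄|φ|². After taking imaginary parts and multiplying
by y, both contributions to y·Im(φψ) are nonnegative, whence y²I|ψ|² ≤ |y||φ||ψ|. This turns growth
of φ into decay of ψ. -/
theorem im_conj_mul_le {φ dφ ψ dψ : ℂ} {y I : ℝ} (hW : φ * dψ - dφ * ψ = -1)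
    (hφ : (dφ * star φ).im = -y * I) (hψ : 0 ≤ y * (dψ * star ψ).im) :
    |y| * I * ‖ψ‖ ≤ ‖φ‖ := by
  rcases eq_or_ne y 0 with rfl | hy
  · simp
  rcases eq_or_ne ψ 0 with rfl | hψ0
  · simp
  have h1 : (φ * ψ).im = (dψ * star ψ).im * ‖φ‖ ^ 2 - (dφ * star φ).im * ‖ψ‖ ^ 2 := by
    have e : star (φ * ψ) = dφ * star φ * ((‖ψ‖ ^ 2 : ℝ) : ℂ) - dψ * star ψ * ((‖φ‖ ^ 2 : ℝ) : ℂ) := by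
      have e1 : ((‖ψ‖ ^ 2 : ℝ) : ℂ) = ψ * star ψ := by
        simp [Complex.mul_conj, Complex.normSq_eq_norm_sq]
      have e2 : ((‖φ‖ ^ 2 : ℝ) : ℂ) = φ * star φ := by
        simp [Complex.mul_conj, Complex.normSq_eq_norm_sq]
      rw [e1, e2, star_mul']
      linear_combination (star φ * star ψ) * hW
    have h := congrArg Complex.im e
    rw [Complex.sub_im, Complex.im_mul_ofReal, Complex.im_mul_ofReal] at h
    have h2 : (star (φ * ψ)).im = -(φ * ψ).im := Complex.conj_im _
    linarith
  rw [hφ] at h1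
  have h2 : |(φ * ψ).im| ≤ ‖φ‖ * ‖ψ‖ := by
    rw [← norm_mul]; exact Complex.abs_im_le_norm _
  have h3 : y * (φ * ψ).im ≤ |y| * (‖φ‖ * ‖ψ‖) :=
    (le_abs_self _).trans (by rw [abs_mul]; gcongr)
  have h4 : |y| * |y| * I * ‖ψ‖ ^ 2 ≤ |y| * (‖φ‖ * ‖ψ‖) := by
    refine le_trans ?_ h3
    rw [h1, abs_mul_abs_self]
    have : 0 ≤ y * (dψ * star ψ).im * ‖φ‖ ^ 2 := by positivity
    linarith
  have h5 : 0 < |y| * ‖ψ‖ := mul_pos (abs_pos.2 hy) (norm_pos_iff.2 hψ0)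
  refine le_of_mul_le_mul_right ?_ h5
  calc _ = |y| * |y| * I * ‖ψ‖ ^ 2 := by ring
    _ ≤ _ := h4
    _ = _ := by ring

section

variable {q : ℝ → ℝ} {a b : ℝ} {z : ℂ} {f df : ℝ → ℂ}

theorem IsSolutionOn.im_deriv_mul_conj (hab : a ≤ b) (hq : IntervalIntegrable q volume a b)
    (hf : IsSolutionOn q z a b f df) {x : ℝ} (hx : x ∈ Icc a b) :
    (df x * star (f x)).im = (df a * star (f a)).im - z.im * ∫ t in a..x, ‖f t‖ ^ 2 := by
  have h := hf.wronskian hab hq hf.conj hx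
  have e : (∫ t in a..x, f t * star (f t)) = ((∫ t in a..x, ‖f t‖ ^ 2 : ℝ) : ℂ) := by
    rw [← intervalIntegral.integral_ofReal]
    congr 1
    ext t
    simp [Complex.mul_conj, Complex.normSq_eq_norm_sq]
  have e2 : z - star z = ((2 * z.im : ℝ) : ℂ) * Complex.I := by
    simpa using Complex.sub_conj z
  rw [e, e2] at h
  have h' := congrArg Complex.im h
  simp only [Complex.sub_im, Complex.add_im, Complex.mul_im, Complex.mul_re, Complex.ofReal_re,
    Complex.ofReal_im, Complex.I_re, Complex.I_im, Complex.star_def, Complex.conj_re,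
    Complex.conj_im] at h' ⊢
  linarith

/-- A zero at x would make z a non-real eigenvalue of a self-adjoint Neumann–Dirichlet problem on
[a, x]. -/
theorem IsSolutionOn.ne_zero_of_neumann (hab : a < b) (hq : IntervalIntegrable q volume a b)
    (hf : IsSolutionOn q z a b f df) (hfa : f a = 1) (hdfa : df a = 0) (hz : z.im ≠ 0) {x : ℝ}
    (hx : x ∈ Icc a b) : f x ≠ 0 := by
  intro h0
  rcases eq_or_lt_of_le hx.1 with rfl | hax
  · exact one_ne_zero (hfa.symm.trans h0)
  have h := hf.im_deriv_mul_conj hab.le hq hx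
  rw [h0, hdfa] at h
  have hpos : 0 < ∫ t in a..x, ‖f t‖ ^ 2 := by
    have hc : ContinuousOn (fun t ↦ ‖f t‖ ^ 2) (Icc a x) :=
      (hf.continuousOn.mono (Icc_subset_Icc_right hx.2)).norm.pow 2
    exact intervalIntegral.integral_pos hax hc (fun t _ ↦ by positivity)
      ⟨a, left_mem_Icc.2 hax.le, by simp [hfa]⟩
  simp only [star_zero, mul_zero, zero_mul, Complex.zero_im, zero_sub, zero_eq_neg] at h
  exact (mul_ne_zero hz hpos.ne') h

end

/-- By Lebesgue differentiation (q₁ - z)f and (q₂ - z)f are both the derivative of `df` almost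
everywhere, and f can be cancelled. -/
theorem ae_eq_of_common_solution {q₁ q₂ : ℝ → ℝ} {a b : ℝ} (hab : a ≤ b)
    (hq₁ : IntervalIntegrable q₁ volume a b) (hq₂ : IntervalIntegrable q₂ volume a b) {z : ℂ}
    {f df : ℝ → ℂ} (h₁ : IsSolutionOn q₁ z a b f df) (h₂ : IsSolutionOn q₂ z a b f df)
    (hf : ∀ x ∈ Icc a b, f x ≠ 0) : q₁ =ᵐ[volume.restrict (Icc a b)] q₂ := by
  rw [← restrict_Ioo_eq_restrict_Icc, Filter.EventuallyEq, ae_restrict_iff' measurableSet_Ioo]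
  have p₁ := h₁.isPrimitiveOn_deriv hab hq₁
  have p₂ := h₂.isPrimitiveOn_deriv hab hq₂
  filter_upwards [p₁.integrable.ae_hasDerivAt_integral, p₂.integrable.ae_hasDerivAt_integral]
    with x hx₁ hx₂ hx
  have hx' : x ∈ Icc a b := Ioo_subset_Icc_self hx
  have hu : x ∈ uIcc a b := by rwa [uIcc_of_le hab]
  have d₁ := hx₁ hu a left_mem_uIcc
  have d₂ := hx₂ hu a left_mem_uIcc
  have hev : (fun x ↦ ∫ t in a..x, ((q₁ t : ℂ) - z) * f t) =ᶠ[nhds x]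
      fun x ↦ ∫ t in a..x, ((q₂ t : ℂ) - z) * f t := by
    filter_upwards [Icc_mem_nhds hx.1 hx.2] with y hy
    have e₁ := p₁.eq_integral y hy
    have e₂ := p₂.eq_integral y hy
    exact add_left_cancel (e₁.symm.trans e₂)
  have h := d₁.unique (d₂.congr_of_eventuallyEq hev)
  have h' := mul_right_cancel₀ (hf x hx') h
  exact_mod_cast sub_left_injective h'

/-! ### The Borg–Marchenko theorem -/

section BorgMarchenko

variable {q₁ q₂ : ℝ → ℝ} {a b : ℝ} {c₁ dc₁ s₁ ds₁ c₂ dc₂ s₂ ds₂ : ℂ → ℝ → ℂ}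

theorem fundamental_wronskian (hab : a ≤ b) (hq₁ : IntervalIntegrable q₁ volume a b)
    (hc₁ : IsAnalyticSolution q₁ a b 1 0 c₁ dc₁) (hs₁ : IsAnalyticSolution q₁ a b 0 1 s₁ ds₁)
    (z : ℂ) {x : ℝ} (hx : x ∈ Icc a b) : c₁ z x * ds₁ z x - dc₁ z x * s₁ z x = 1 := by
  rw [(hc₁.isSolutionOn z).wronskian hab hq₁ (hs₁.isSolutionOn z) hx]
  simp [hc₁.initial, hc₁.initial_deriv, hs₁.initial, hs₁.initial_deriv]

/-- Put X = exp(Im k (x - a)) with k² = z, so |Im z| = |k|². Since |c₁| ≤ 2X and ∫|c₁|² ≥ X²/(64 Im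
k), `im_conj_mul_le` yields |ψ₁| ≤ 128/(|k|X); multiply by |c₂| ≤ 2X. The sign condition is all that
is needed of `m₁`. -/
theorem norm_mul_weyl_le (hab : a ≤ b) (hq₁ : IntervalIntegrable q₁ volume a b)
    (hq₂ : IntervalIntegrable q₂ volume a b)
    (hc₁ : IsAnalyticSolution q₁ a b 1 0 c₁ dc₁) (hs₁ : IsAnalyticSolution q₁ a b 0 1 s₁ ds₁)
    (hc₂ : IsAnalyticSolution q₂ a b 1 0 c₂ dc₂) {m₁ : ℂ → ℂ}
    (hsign₁ : ∀ z : ℂ, z.im ≠ 0 → ∀ x ∈ Icc a b,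
      0 ≤ z.im * ((m₁ z * dc₁ z x - ds₁ z x) * star (m₁ z * c₁ z x - s₁ z x)).im)
    {x : ℝ} (hx : x ∈ Icc a b) {z : ℂ} (hz : z.re = 0) (h1 : 1 ≤ √‖z‖)
    (hQ₁ : 16 * (∫ t in a..b, |q₁ t|) ≤ √‖z‖) (hQ₂ : 16 * (∫ t in a..b, |q₂ t|) ≤ √‖z‖)
    (hzx : 4 ≤ √‖z‖ * (x - a)) :
    ‖c₂ z x * (m₁ z * c₁ z x - s₁ z x)‖ ≤ 256 / √‖z‖ := by
  obtain ⟨k, hk, hk0, hkn⟩ := exists_sq_eq_im_nonneg z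
  rw [← hkn] at h1 hQ₁ hQ₂ hzx ⊢
  have hkne : k ≠ 0 := by
    rintro rfl
    norm_num at h1
  have hk2 : ‖k‖ ≤ 2 * k.im := norm_le_two_mul_im (by rw [hk, hz]) hk0
  have hkpos : 0 < k.im := by linarith
  have hzn : ‖z‖ = ‖k‖ ^ 2 := by rw [← hk, norm_pow]
  have hzim : |z.im| = ‖k‖ ^ 2 := by
    rw [← hzn, ← Complex.abs_im_eq_norm.2 hz]
  have hz0 : z.im ≠ 0 := by
    rw [← abs_pos, hzim]; positivity
  have hQ₁0 : 0 ≤ ∫ t in a..b, |q₁ t| := intervalIntegral.integral_nonneg hab fun t _ ↦ abs_nonneg _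
  have hQ₂0 : 0 ≤ ∫ t in a..b, |q₂ t| := intervalIntegral.integral_nonneg hab fun t _ ↦ abs_nonneg _
  have hy : 2 ≤ k.im * (x - a) := by
    nlinarith [hx.1, mul_le_mul_of_nonneg_right hk2 (sub_nonneg.2 hx.1)]
  have S := hc₁.isSolutionOn z
  have hS1 := hc₁.initial z
  have hS2 := hc₁.initial_deriv z
  set X := Real.exp (k.im * (x - a)) with hX
  have hXpos : 0 < X := Real.exp_pos _
  have b₁ : ‖c₁ z x‖ ≤ 2 * X := by
    simpa [hS1, hS2] using S.norm_le hab hq₁ hk hk0 h1 (by linarith) hx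
  have b₂ : ‖c₂ z x‖ ≤ 2 * X := by
    simpa [hc₂.initial z, hc₂.initial_deriv z] using
      (hc₂.isSolutionOn z).norm_le hab hq₂ hk hk0 h1 (by linarith) hx
  have hI := S.le_integral_norm_sq hab hq₁ hS1 hS2 hk hkpos h1 hQ₁ hx hy
  have hexp : Real.exp (2 * (k.im * (x - a))) = X ^ 2 := by
    rw [hX, ← Real.exp_nat_mul]; norm_num
  rw [hexp] at hI
  have hW := fundamental_wronskian hab hq₁ hc₁ hs₁ z hx
  have hψ := im_conj_mul_le (φ := c₁ z x) (dφ := dc₁ z x) (ψ := m₁ z * c₁ z x - s₁ z x)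
    (dψ := m₁ z * dc₁ z x - ds₁ z x) (y := z.im) (I := ∫ t in a..x, ‖c₁ z t‖ ^ 2)
    (by linear_combination -hW)
    (by rw [S.im_deriv_mul_conj hab hq₁ hx, hS1, hS2]; simp) (hsign₁ z hz0 x hx)
  set P := ‖m₁ z * c₁ z x - s₁ z x‖ with hP
  have hP0 : 0 ≤ P := norm_nonneg _
  rw [hzim] at hψ
  have h3 : ‖k‖ ^ 2 * (X ^ 2 / (64 * k.im)) * P ≤ 2 * X := by
    refine le_trans ?_ (hψ.trans b₁)
    gcongr
  have hkim : k.im ≤ ‖k‖ := (le_abs_self _).trans (Complex.abs_im_le_norm k)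
  have h4 : ‖k‖ * X * P ≤ 128 := by
    have h5 : ‖k‖ ^ 2 * X ^ 2 * P ≤ 2 * X * (64 * k.im) := by
      rw [← div_le_iff₀ (by positivity)]
      calc _ = _ := by ring
        _ ≤ _ := h3
    have h6 : (‖k‖ * X) * (‖k‖ * X * P) ≤ (‖k‖ * X) * 128 := by
      nlinarith
    exact le_of_mul_le_mul_left h6 (by positivity)
  rw [norm_mul, ← hP, le_div_iff₀ (by positivity)]
  calc ‖c₂ z x‖ * P * ‖k‖ ≤ 2 * X * P * ‖k‖ := by gcongr
    _ = 2 * (‖k‖ * X * P) := by ring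
    _ ≤ _ := by linarith

theorem fundamental_cross_eq (hab : a < b) (hq₁ : IntervalIntegrable q₁ volume a b)
    (hq₂ : IntervalIntegrable q₂ volume a b)
    (hc₁ : IsAnalyticSolution q₁ a b 1 0 c₁ dc₁) (hs₁ : IsAnalyticSolution q₁ a b 0 1 s₁ ds₁)
    (hc₂ : IsAnalyticSolution q₂ a b 1 0 c₂ dc₂) (hs₂ : IsAnalyticSolution q₂ a b 0 1 s₂ ds₂)
    {m₁ m₂ h : ℂ → ℂ} (hh : Differentiable ℂ h) {C : ℝ} (hC : ∀ z, 1 ≤ ‖z‖ → ‖h z‖ ≤ C * ‖z‖)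
    (hm : ∀ z : ℂ, z.im ≠ 0 → m₁ z - m₂ z = h z)
    (hsign₁ : ∀ z : ℂ, z.im ≠ 0 → ∀ x ∈ Icc a b,
      0 ≤ z.im * ((m₁ z * dc₁ z x - ds₁ z x) * star (m₁ z * c₁ z x - s₁ z x)).im)
    (hsign₂ : ∀ z : ℂ, z.im ≠ 0 → ∀ x ∈ Icc a b,
      0 ≤ z.im * ((m₂ z * dc₂ z x - ds₂ z x) * star (m₂ z * c₂ z x - s₂ z x)).im)
    {x : ℝ} (hx : x ∈ Ioc a b) (z : ℂ) :
    h z * (c₁ z x * c₂ z x) + c₁ z x * s₂ z x - c₂ z x * s₁ z x = 0 := by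
  have hx' : x ∈ Icc a b := Ioc_subset_Icc_self hx
  have hxa : 0 < x - a := sub_pos.2 hx.1
  have hQ₁0 : 0 ≤ ∫ t in a..b, |q₁ t| :=
    intervalIntegral.integral_nonneg hab.le fun t _ ↦ abs_nonneg _
  have hQ₂0 : 0 ≤ ∫ t in a..b, |q₂ t| :=
    intervalIntegral.integral_nonneg hab.le fun t _ ↦ abs_nonneg _
  have hdiv : 0 ≤ 4 / (x - a) := by positivity
  -- |k| ≥ ρ meets every threshold of the asymptotic bounds at once; the last summand is why x = a
  -- is excluded.
  set ρ : ℝ := 1 + 16 * (∫ t in a..b, |q₁ t|) + 16 * (∫ t in a..b, |q₂ t|) + 4 / (x - a) with hρ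
  have hρ1 : 1 ≤ ρ := by linarith
  have hsqrt : ∀ z : ℂ, ρ ^ 2 ≤ ‖z‖ → ρ ≤ √‖z‖ := fun z hz ↦ Real.le_sqrt_of_sq_le hz
  have hd : Differentiable ℂ fun z ↦
      h z * (c₁ z x * c₂ z x) + c₁ z x * s₂ z x - c₂ z x * s₁ z x :=
    ((hh.mul ((hc₁.differentiable x hx').mul (hc₂.differentiable x hx'))).add
      ((hc₁.differentiable x hx').mul (hs₂.differentiable x hx'))).sub
      ((hc₂.differentiable x hx').mul (hs₁.differentiable x hx'))
  have hC0 : 0 ≤ C := by simpa using (norm_nonneg _).trans (hC 1 (by simp))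
  -- In B, the 2 absorbs |h| ≤ C|k|² ≤ C exp(2|k|), and 2(x - a) comes from products of two
  -- solutions. K is twice 256.
  refine eq_zero_of_norm_le_exp_sqrt hd (R := ρ ^ 2) (A := 4 * C + 8) (B := 2 + 2 * (x - a))
    (K := 512) (one_le_pow₀ hρ1) (fun z hz ↦ ?_) (fun z hre hz ↦ ?_) z
  · obtain ⟨k, hk, hk0, hkn⟩ := exists_sq_eq_im_nonneg z
    have ht := hsqrt z hz
    rw [← hkn] at ht ⊢
    have hkim : k.im ≤ ‖k‖ := (le_abs_self _).trans (Complex.abs_im_le_norm k)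
    set X := Real.exp (‖k‖ * (x - a)) with hX
    have hX0 : 0 < X := Real.exp_pos _
    have hexp : Real.exp (k.im * (x - a)) ≤ X := Real.exp_le_exp.2 (by gcongr)
    have bound : ∀ {q : ℝ → ℝ} {α β : ℂ} {f df : ℂ → ℝ → ℂ}, IntervalIntegrable q volume a b →
        2 * (∫ t in a..b, |q t|) ≤ ‖k‖ → ‖α‖ + ‖β‖ = 1 → IsAnalyticSolution q a b α β f df →
        ‖f z x‖ ≤ 2 * X := by
      intro q α β f df hq hQ hαβ hf
      have := (hf.isSolutionOn z).norm_le hab.le hq hk hk0 (by linarith) hQ hx'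
      rw [hf.initial, hf.initial_deriv, hαβ] at this
      linarith
    have e1 := bound hq₁ (by linarith) (by simp) hc₁
    have e2 := bound hq₁ (by linarith) (by simp) hs₁
    have e3 := bound hq₂ (by linarith) (by simp) hc₂
    have e4 := bound hq₂ (by linarith) (by simp) hs₂
    have hzn : ‖z‖ = ‖k‖ ^ 2 := by rw [← hk, norm_pow]
    have e5 : ‖h z‖ ≤ C * Real.exp (2 * ‖k‖) := by
      refine (hC z ?_).trans ?_
      · rw [hzn]; exact one_le_pow₀ (by linarith)
      · rw [hzn]
        gcongr
        calc ‖k‖ ^ 2 ≤ Real.exp ‖k‖ ^ 2 := by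
              gcongr
              linarith [Real.add_one_le_exp ‖k‖]
          _ = _ := by rw [← Real.exp_nat_mul]; norm_num
    have hY1 : 1 ≤ Real.exp (2 * ‖k‖) := Real.one_le_exp (by positivity)
    have hfin : Real.exp ((2 + 2 * (x - a)) * ‖k‖) = Real.exp (2 * ‖k‖) * X ^ 2 := by
      rw [hX, ← Real.exp_nat_mul, ← Real.exp_add]
      congr 1
      push_cast
      ring
    rw [hfin]
    calc _ ≤ ‖h z‖ * (‖c₁ z x‖ * ‖c₂ z x‖) + ‖c₁ z x‖ * ‖s₂ z x‖ + ‖c₂ z x‖ * ‖s₁ z x‖ := by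
          refine (norm_sub_le _ _).trans ?_
          rw [norm_mul (c₂ z x)]
          gcongr
          refine (norm_add_le _ _).trans ?_
          simp only [norm_mul, le_refl]
      _ ≤ C * Real.exp (2 * ‖k‖) * (2 * X * (2 * X)) + 2 * X * (2 * X) + 2 * X * (2 * X) := by
          gcongr
      _ ≤ _ := by nlinarith [mul_le_mul_of_nonneg_right hY1 (sq_nonneg X)]
  · have ht := hsqrt z hz
    have hzx : 4 ≤ √‖z‖ * (x - a) := by
      rw [← div_le_iff₀ hxa]; linarith
    have hz0 : z.im ≠ 0 := by
      intro h0
      have : z = 0 := Complex.ext hre h0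
      rw [this, norm_zero] at hz
      nlinarith
    have h1 := norm_mul_weyl_le hab.le hq₁ hq₂ hc₁ hs₁ hc₂ hsign₁ hx' hre (by linarith)
      (by linarith) (by linarith) hzx
    have h2 := norm_mul_weyl_le hab.le hq₂ hq₁ hc₂ hs₂ hc₁ hsign₂ hx' hre (by linarith)
      (by linarith) (by linarith) hzx
    have e : h z * (c₁ z x * c₂ z x) + c₁ z x * s₂ z x - c₂ z x * s₁ z x =
        c₂ z x * (m₁ z * c₁ z x - s₁ z x) - c₁ z x * (m₂ z * c₂ z x - s₂ z x) := by
      rw [← hm z hz0]; ring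
    rw [e]
    refine (norm_sub_le _ _).trans ((add_le_add h1 h2).trans_eq ?_)
    ring

/-- **Borg–Marchenko uniqueness theorem** on a compact interval: a potential is determined by a
Weyl function, up to an entire function of linear growth. -/
theorem borg_marchenko (hab : a < b) (hq₁ : IntervalIntegrable q₁ volume a b)
    (hq₂ : IntervalIntegrable q₂ volume a b)
    (hc₁ : IsAnalyticSolution q₁ a b 1 0 c₁ dc₁) (hs₁ : IsAnalyticSolution q₁ a b 0 1 s₁ ds₁)
    (hc₂ : IsAnalyticSolution q₂ a b 1 0 c₂ dc₂) (hs₂ : IsAnalyticSolution q₂ a b 0 1 s₂ ds₂)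
    {m₁ m₂ h : ℂ → ℂ} (hh : Differentiable ℂ h) {C : ℝ} (hC : ∀ z, 1 ≤ ‖z‖ → ‖h z‖ ≤ C * ‖z‖)
    (hm : ∀ z : ℂ, z.im ≠ 0 → m₁ z - m₂ z = h z)
    (hsign₁ : ∀ z : ℂ, z.im ≠ 0 → ∀ x ∈ Icc a b,
      0 ≤ z.im * ((m₁ z * dc₁ z x - ds₁ z x) * star (m₁ z * c₁ z x - s₁ z x)).im)
    (hsign₂ : ∀ z : ℂ, z.im ≠ 0 → ∀ x ∈ Icc a b,
      0 ≤ z.im * ((m₂ z * dc₂ z x - ds₂ z x) * star (m₂ z * c₂ z x - s₂ z x)).im) :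
    (∀ z : ℂ, z.im ≠ 0 → m₁ z = m₂ z) ∧
    (∀ z : ℂ, z.im ≠ 0 → ∀ x ∈ Icc a b,
      c₁ z x = c₂ z x ∧ dc₁ z x = dc₂ z x ∧ s₁ z x = s₂ z x ∧ ds₁ z x = ds₂ z x) ∧
    q₁ =ᵐ[volume.restrict (Icc a b)] q₂ := by
  have hcross := fun (z : ℂ) (x : ℝ) (hx : x ∈ Ioc a b) ↦ fundamental_cross_eq hab hq₁ hq₂ hc₁ hs₁
    hc₂ hs₂ hh hC hm hsign₁ hsign₂ hx z
  -- Continuity in x adds the endpoint a, where the identity reduces to h = 0.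
  have hcross' : ∀ z : ℂ, ∀ x ∈ Icc a b,
      h z * (c₁ z x * c₂ z x) + c₁ z x * s₂ z x - c₂ z x * s₁ z x = 0 := by
    intro z
    have hc : ContinuousOn (fun x ↦ h z * (c₁ z x * c₂ z x) + c₁ z x * s₂ z x - c₂ z x * s₁ z x)
        (Icc a b) := by
      have k1 := (hc₁.isSolutionOn z).continuousOn
      have k2 := (hc₂.isSolutionOn z).continuousOn
      have k3 := (hs₁.isSolutionOn z).continuousOn
      have k4 := (hs₂.isSolutionOn z).continuousOn
      fun_prop
    exact (show EqOn _ (fun _ ↦ (0 : ℂ)) (Ioc a b) from hcross z).of_subset_closure hc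
      continuousOn_const Ioc_subset_Icc_self (by rw [closure_Ioc hab.ne])
  have ha : a ∈ Icc a b := left_mem_Icc.2 hab.le
  have hh0 : ∀ z, h z = 0 := fun z ↦ by
    simpa [hc₁.initial, hc₂.initial, hs₁.initial, hs₂.initial] using hcross' z a ha
  have hud := uniqueDiffOn_Icc hab
  have heq : ∀ z : ℂ, z.im ≠ 0 → ∀ x ∈ Icc a b,
      c₁ z x = c₂ z x ∧ dc₁ z x = dc₂ z x ∧ s₁ z x = s₂ z x ∧ ds₁ z x = ds₂ z x := by
    intro z hz
    have n₁ := fun x (hx : x ∈ Icc a b) ↦ (hc₁.isSolutionOn z).ne_zero_of_neumann hab hq₁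
      (hc₁.initial z) (hc₁.initial_deriv z) hz hx
    have n₂ := fun x (hx : x ∈ Icc a b) ↦ (hc₂.isSolutionOn z).ne_zero_of_neumann hab hq₂
      (hc₂.initial z) (hc₂.initial_deriv z) hz hx
    have hquot : EqOn (fun x ↦ s₁ z x / c₁ z x) (fun x ↦ s₂ z x / c₂ z x) (Icc a b) := by
      intro x hx
      have := hcross' z x hx
      rw [hh0] at this
      simp only
      rw [div_eq_div_iff (n₁ x hx) (n₂ x hx)]
      linear_combination -this
    -- The Wronskian being 1, the derivative of s/c is 1/c².
    have hsq : EqOn ((fun x ↦ c₁ z x) ^ 2) ((fun x ↦ c₂ z x) ^ 2) (Icc a b) := by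
      intro x hx
      have d₁ := ((hs₁.isSolutionOn z).hasDeriv x hx).div ((hc₁.isSolutionOn z).hasDeriv x hx)
        (n₁ x hx)
      have d₂ := ((hs₂.isSolutionOn z).hasDeriv x hx).div ((hc₂.isSolutionOn z).hasDeriv x hx)
        (n₂ x hx)
      have e := (hud x hx).eq_deriv _ d₁ (d₂.congr hquot (hquot hx))
      have w₁ := fundamental_wronskian hab.le hq₁ hc₁ hs₁ z hx
      have w₂ := fundamental_wronskian hab.le hq₂ hc₂ hs₂ z hx
      have w₁' : ds₁ z x * c₁ z x - s₁ z x * dc₁ z x = 1 := by linear_combination w₁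
      have w₂' : ds₂ z x * c₂ z x - s₂ z x * dc₂ z x = 1 := by linear_combination w₂
      rw [w₁', w₂', div_eq_div_iff (pow_ne_zero 2 (n₁ x hx)) (pow_ne_zero 2 (n₂ x hx))] at e
      simp only [Pi.pow_apply]
      linear_combination -e
    have hcc : EqOn (fun x ↦ c₁ z x) (fun x ↦ c₂ z x) (Icc a b) := by
      rcases isPreconnected_Icc.eq_or_eq_neg_of_sq_eq (hc₁.isSolutionOn z).continuousOn
        (hc₂.isSolutionOn z).continuousOn hsq (fun {x} hx ↦ n₂ x hx) with h | h
      · exact h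
      · have := h ha
        simp only [Pi.neg_apply, hc₁.initial, hc₂.initial] at this
        norm_num at this
    have hss : EqOn (fun x ↦ s₁ z x) (fun x ↦ s₂ z x) (Icc a b) := by
      intro x hx
      have e := hquot hx
      have e' := hcc hx
      simp only at e e'
      rw [e'] at e
      exact (div_left_inj' (n₂ x hx)).1 e
    intro x hx
    exact ⟨hcc hx, (hud x hx).eq_deriv _ ((hc₁.isSolutionOn z).hasDeriv x hx)
      (((hc₂.isSolutionOn z).hasDeriv x hx).congr hcc (hcc hx)), hss hx,
      (hud x hx).eq_deriv _ ((hs₁.isSolutionOn z).hasDeriv x hx)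
      (((hs₂.isSolutionOn z).hasDeriv x hx).congr hss (hss hx))⟩
  refine ⟨fun z hz ↦ sub_eq_zero.1 ((hm z hz).trans (hh0 z)), heq, ?_⟩
  have hI : Complex.I.im ≠ 0 := by simp
  have H₂ : IsSolutionOn q₂ Complex.I a b (c₁ Complex.I) (dc₁ Complex.I) := by
    have h₂ := hc₂.isSolutionOn Complex.I
    have e₁ : EqOn (c₁ Complex.I) (c₂ Complex.I) (Icc a b) := fun x hx ↦ (heq _ hI x hx).1
    refine ⟨(hc₁.isSolutionOn Complex.I).hasDeriv, fun x hx ↦ ?_⟩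
    rw [(heq _ hI x hx).2.1, (heq _ hI a ha).2.1, h₂.eq_integral x hx]
    congr 1
    refine intervalIntegral.integral_congr fun t ht ↦ ?_
    rw [uIcc_of_le hx.1] at ht
    simp only [e₁ ⟨ht.1, ht.2.trans hx.2⟩]
  exact ae_eq_of_common_solution hab.le hq₁ hq₂ (hc₁.isSolutionOn Complex.I) H₂ fun x hx ↦
    (hc₁.isSolutionOn _).ne_zero_of_neumann hab hq₁ (hc₁.initial _) (hc₁.initial_deriv _) hI hx

end BorgMarchenko

/-- f and g have equal Wronskians with both members of a fundamental system, and these determine the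
values by Cramer's rule. -/
theorem IsSolutionOn.eqOn_of_initial {q : ℝ → ℝ} {a b : ℝ} {z : ℂ} {f df g dg : ℝ → ℂ}
    (hab : a ≤ b) (hq : IntervalIntegrable q volume a b) (hf : IsSolutionOn q z a b f df)
    (hg : IsSolutionOn q z a b g dg) (h : f a = g a) (hd : df a = dg a) :
    EqOn f g (Icc a b) ∧ EqOn df dg (Icc a b) := by
  obtain ⟨c, dc, hc⟩ := exists_isAnalyticSolution hab hq 1 0
  obtain ⟨s, ds, hs⟩ := exists_isAnalyticSolution hab hq 0 1
  have key : ∀ x ∈ Icc a b, f x = g x ∧ df x = dg x := by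
    intro x hx
    have hW := fundamental_wronskian hab hq hc hs z hx
    have h1 := hf.wronskian hab hq (hc.isSolutionOn z) hx
    have h2 := hf.wronskian hab hq (hs.isSolutionOn z) hx
    have h3 := hg.wronskian hab hq (hc.isSolutionOn z) hx
    have h4 := hg.wronskian hab hq (hs.isSolutionOn z) hx
    rw [h, hd, sub_self, zero_mul, add_zero] at h1 h2
    rw [sub_self, zero_mul, add_zero] at h3 h4
    have e1 := h1.trans h3.symm
    have e2 := h2.trans h4.symm
    constructor
    · linear_combination (f x - g x) * (-hW) + c z x * e2 - s z x * e1
    · linear_combination (df x - dg x) * (-hW) + dc z x * e2 - ds z x * e1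
  exact ⟨fun x hx ↦ (key x hx).1, fun x hx ↦ (key x hx).2⟩

/-! ### Solutions across the transfer condition -/

/-- A solution of the equation on both halves of `[-S, S]` satisfying the transfer condition. -/
structure IsTransferPair (S : ℝ) (q : ℝ → ℝ) (M : Matrix (Fin 2) (Fin 2) ℝ) (z : ℂ)
    (l dl r dr : ℝ → ℂ) : Prop where
  left : IsSolutionOn q z (-S) 0 l dl
  right : IsSolutionOn q z 0 S r dr
  transfer : r 0 = M 0 0 * l 0 + M 0 1 * dl 0
  transfer_deriv : dr 0 = M 1 0 * l 0 + M 1 1 * dl 0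

section Pair

variable {S : ℝ} {q : ℝ → ℝ} {M : Matrix (Fin 2) (Fin 2) ℝ} {z ζ : ℂ}
  {l dl r dr l' dl' r' dr' : ℝ → ℂ}

theorem det_ofReal (hM : M.det = 1) :
    (M 0 0 : ℂ) * M 1 1 - (M 0 1 : ℂ) * M 1 0 = 1 := by
  rw [Matrix.det_fin_two] at hM
  exact_mod_cast hM

/-- Lagrange's identity on the two halves glues because det M = 1 preserves the Wronskian at 0. -/
theorem IsTransferPair.wronskian (hS : 0 ≤ S) (hL : IntervalIntegrable q volume (-S) 0)
    (hR : IntervalIntegrable q volume 0 S) (hM : M.det = 1)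
    (h : IsTransferPair S q M z l dl r dr) (h' : IsTransferPair S q M ζ l' dl' r' dr') :
    r S * dr' S - dr S * r' S = l (-S) * dl' (-S) - dl (-S) * l' (-S) +
      (z - ζ) * ((∫ t in (-S)..0, l t * l' t) + ∫ t in 0..S, r t * r' t) := by
  have h1 := h.left.wronskian (by linarith) hL h'.left (x := 0) ⟨by linarith, le_rfl⟩
  have h2 := h.right.wronskian hS hR h'.right (x := S) ⟨hS, le_rfl⟩
  have h3 : r 0 * dr' 0 - dr 0 * r' 0 = l 0 * dl' 0 - dl 0 * l' 0 := by
    rw [h.transfer, h.transfer_deriv, h'.transfer, h'.transfer_deriv]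
    linear_combination (l 0 * dl' 0 - dl 0 * l' 0) * det_ofReal hM
  rw [h2, h3, h1]
  ring

theorem IsTransferPair.linear_combination (hS : 0 ≤ S) (hL : IntervalIntegrable q volume (-S) 0)
    (hR : IntervalIntegrable q volume 0 S)
    (h : IsTransferPair S q M z l dl r dr) (h' : IsTransferPair S q M z l' dl' r' dr') (α β : ℂ) :
    IsTransferPair S q M z (fun x ↦ α * l x + β * l' x) (fun x ↦ α * dl x + β * dl' x)
      (fun x ↦ α * r x + β * r' x) (fun x ↦ α * dr x + β * dr' x) where
  left := h.left.linear_combination (by linarith) hL h'.left α β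
  right := h.right.linear_combination hS hR h'.right α β
  transfer := by rw [h.transfer, h'.transfer]; ring
  transfer_deriv := by rw [h.transfer_deriv, h'.transfer_deriv]; ring

theorem IsTransferPair.conj (h : IsTransferPair S q M z l dl r dr) :
    IsTransferPair S q M (star z) (fun x ↦ star (l x)) (fun x ↦ star (dl x))
      (fun x ↦ star (r x)) (fun x ↦ star (dr x)) where
  left := h.left.conj
  right := h.right.conj
  transfer := by simp [h.transfer]
  transfer_deriv := by simp [h.transfer_deriv]

theorem IsTransferPair.eqOn_of_initial (hS : 0 ≤ S) (hL : IntervalIntegrable q volume (-S) 0)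
    (hR : IntervalIntegrable q volume 0 S)
    (h : IsTransferPair S q M z l dl r dr) (h' : IsTransferPair S q M z l' dl' r' dr')
    (hi : l (-S) = l' (-S)) (hd : dl (-S) = dl' (-S)) :
    EqOn l l' (Icc (-S) 0) ∧ EqOn r r' (Icc 0 S) ∧ EqOn dr dr' (Icc 0 S) := by
  have h1 := h.left.eqOn_of_initial (by linarith) hL h'.left hi hd
  have h0 : (0 : ℝ) ∈ Icc (-S) 0 := ⟨by linarith, le_rfl⟩
  exact ⟨h1.1, h.right.eqOn_of_initial hS hR h'.right
    (by rw [h.transfer, h'.transfer, h1.1 h0, h1.2 h0])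
    (by rw [h.transfer_deriv, h'.transfer_deriv, h1.1 h0, h1.2 h0])⟩

theorem IsTransferPair.im_transfer (hM : M.det = 1) (h : IsTransferPair S q M z l dl r dr) :
    (dr 0 * star (r 0)).im = (dl 0 * star (l 0)).im := by
  rw [Matrix.det_fin_two] at hM
  rw [h.transfer, h.transfer_deriv]
  simp only [Complex.mul_im, Complex.mul_re, Complex.add_re, Complex.add_im, Complex.ofReal_re,
    Complex.ofReal_im, Complex.star_def, Complex.conj_re, Complex.conj_im]
  linear_combination ((dl 0).im * (l 0).re - (dl 0).re * (l 0).im) * hM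

theorem IsTransferPair.im_deriv_mul_conj (hS : 0 ≤ S) (hL : IntervalIntegrable q volume (-S) 0)
    (hR : IntervalIntegrable q volume 0 S) (hM : M.det = 1)
    (h : IsTransferPair S q M z l dl r dr) {x : ℝ} (hx : x ∈ Icc 0 S) :
    (dr x * star (r x)).im = (dl (-S) * star (l (-S))).im -
      z.im * ((∫ t in (-S)..0, ‖l t‖ ^ 2) + ∫ t in 0..x, ‖r t‖ ^ 2) := by
  rw [h.right.im_deriv_mul_conj hS hR hx, h.im_transfer hM,
    h.left.im_deriv_mul_conj (by linarith) hL (x := 0) ⟨by linarith, le_rfl⟩]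
  ring

theorem IsTransferPair.integral_sq (hS : 0 < S) (h : IsTransferPair S q M z l dl r dr)
    {y : ℝ → ℂ} (hyl : EqOn y l (Ico (-S) 0)) (hyr : EqOn y r (Ioc 0 S)) :
    ∫ x in (-S)..S, y x ^ 2 = (∫ t in (-S)..0, l t ^ 2) + ∫ t in 0..S, r t ^ 2 := by
  have il : IntervalIntegrable (fun t ↦ l t ^ 2) volume (-S) 0 :=
    ContinuousOn.intervalIntegrable (by
      rw [uIcc_of_le (by linarith)]; exact h.left.continuousOn.pow 2)
  have ir : IntervalIntegrable (fun t ↦ r t ^ 2) volume 0 S :=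
    ContinuousOn.intervalIntegrable (by
      rw [uIcc_of_le hS.le]; exact h.right.continuousOn.pow 2)
  have el : ∀ᵐ t, t ∈ uIoc (-S) 0 → l t ^ 2 = y t ^ 2 := by
    filter_upwards [compl_mem_ae_iff.2 (measure_singleton (μ := volume) (0 : ℝ))] with t ht0 ht
    rw [uIoc_of_le (by linarith)] at ht
    rw [hyl ⟨ht.1.le, lt_of_le_of_ne ht.2 ht0⟩]
  have er : EqOn (fun t ↦ r t ^ 2) (fun t ↦ y t ^ 2) (uIoc 0 S) := by
    intro t ht
    rw [uIoc_of_le hS.le] at ht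
    simp only [hyr ht]
  have il' : IntervalIntegrable (fun t ↦ y t ^ 2) volume (-S) 0 :=
    il.congr_ae ((ae_restrict_iff' measurableSet_uIoc).2 el)
  rw [← intervalIntegral.integral_add_adjacent_intervals il' (ir.congr er),
    intervalIntegral.integral_congr_ae el]
  congr 1
  exact (intervalIntegral.integral_congr_ae (Filter.Eventually.of_forall fun t ht ↦ er ht)).symm

theorem IsTransferPair.isTransferSolution (h : IsTransferPair S q M z l dl r dr) :
    IsTransferSolution S q M z (fun x ↦ if x < 0 then l x else r x)
      (fun x ↦ if x < 0 then dl x else dr x) :=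
  ⟨l, dl, r, dr, h.left, h.right, fun x hx ↦ by simp [hx.2], fun x hx ↦ by simp [hx.2],
    fun x hx ↦ by simp [hx.1.le], fun x hx ↦ by simp [hx.1.le], h.transfer, h.transfer_deriv⟩

end Pair

/-- A family of transfer solutions with fixed initial data at `-S`, depending analytically on the
spectral parameter. -/
structure IsTransferFamily (S : ℝ) (q : ℝ → ℝ) (M : Matrix (Fin 2) (Fin 2) ℝ) (α β : ℂ)
    (l dl r dr : ℂ → ℝ → ℂ) : Prop where
  left : IsAnalyticSolution q (-S) 0 α β l dl
  pair : ∀ z, IsTransferPair S q M z (l z) (dl z) (r z) (dr z)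
  continuous_right : Continuous (Function.uncurry r)
  differentiable_deriv : Differentiable ℂ fun z ↦ dr z S

theorem IsAnalyticSolution.exists_isTransferFamily {S : ℝ} (hS : 0 ≤ S) {q : ℝ → ℝ}
    (hR : IntervalIntegrable q volume 0 S) (M : Matrix (Fin 2) (Fin 2) ℝ) {α β : ℂ}
    {l dl : ℂ → ℝ → ℂ} (h : IsAnalyticSolution q (-S) 0 α β l dl) :
    ∃ r dr, IsTransferFamily S q M α β l dl r dr := by
  obtain ⟨c, dc, hc⟩ := exists_isAnalyticSolution hS hR 1 0
  obtain ⟨s, ds, hs⟩ := exists_isAnalyticSolution hS hR 0 1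
  have h0 : (0 : ℝ) ∈ Icc (-S) 0 := ⟨by linarith, le_rfl⟩
  have hSS : S ∈ Icc 0 S := ⟨hS, le_rfl⟩
  have d1 := h.differentiable 0 h0
  have d2 := h.differentiable_deriv 0 h0
  have d3 := hc.differentiable_deriv S hSS
  have d4 := hs.differentiable_deriv S hSS
  have dA : Differentiable ℂ fun z ↦ M 0 0 * l z 0 + M 0 1 * dl z 0 := by fun_prop
  have dB : Differentiable ℂ fun z ↦ M 1 0 * l z 0 + M 1 1 * dl z 0 := by fun_prop
  refine ⟨fun z x ↦ (M 0 0 * l z 0 + M 0 1 * dl z 0) * c z x +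
    (M 1 0 * l z 0 + M 1 1 * dl z 0) * s z x, fun z x ↦ (M 0 0 * l z 0 + M 0 1 * dl z 0) * dc z x +
    (M 1 0 * l z 0 + M 1 1 * dl z 0) * ds z x, h, fun z ↦ ⟨h.isSolutionOn z,
      (hc.isSolutionOn z).linear_combination hS hR (hs.isSolutionOn z) _ _, ?_, ?_⟩, ?_, ?_⟩
  · simp [hc.initial, hs.initial]
  · simp [hc.initial_deriv, hs.initial_deriv]
  · have k1 := hc.continuous
    have k2 := hs.continuous
    exact ((dA.continuous.comp continuous_fst).mul k1).add
      ((dB.continuous.comp continuous_fst).mul k2)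
  · exact (dA.mul d3).add (dB.mul d4)

/-! ### The Weyl function of the Neumann–Neumann problem -/

section WeylFunction

open Filter Topology

variable {S : ℝ} {q : ℝ → ℝ} {M : Matrix (Fin 2) (Fin 2) ℝ}
  {l₁ dl₁ r₁ dr₁ l₂ dl₂ r₂ dr₂ : ℂ → ℝ → ℂ}

theorem IsTransferFamily.integral_norm_sq_pos (hS : 0 < S) {β : ℂ}
    (h : IsTransferFamily S q M 1 β l₁ dl₁ r₁ dr₁) (z : ℂ) :
    0 < (∫ t in (-S)..0, ‖l₁ z t‖ ^ 2) + ∫ t in 0..S, ‖r₁ z t‖ ^ 2 := by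
  refine add_pos_of_pos_of_nonneg ?_
    (intervalIntegral.integral_nonneg hS.le fun t _ ↦ by positivity)
  exact intervalIntegral.integral_pos (by linarith) ((h.pair z).left.continuousOn.norm.pow 2)
    (fun t _ ↦ by positivity) ⟨-S, ⟨le_rfl, by linarith⟩, by simp [h.left.initial]⟩

theorem mem_neumannSpectrum_iff (hS : 0 < S) (hL : IntervalIntegrable q volume (-S) 0)
    (hR : IntervalIntegrable q volume 0 S) (h₁ : IsTransferFamily S q M 1 0 l₁ dl₁ r₁ dr₁)
    {z : ℂ} : z ∈ neumannSpectrum S q M ↔ dr₁ z S = 0 := by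
  constructor
  · rintro ⟨y, dy, ⟨l, dl, r, dr, hl, hr, hyl, hdyl, hyr, hdyr, ht, htd⟩, hd, hdS, x, hx, hyx⟩
    have hmem : -S ∈ Ico (-S) 0 := ⟨le_rfl, by linarith⟩
    have hmem' : S ∈ Ioc 0 S := ⟨hS, le_rfl⟩
    have hP : IsTransferPair S q M z l dl r dr := ⟨hl, hr, ht, htd⟩
    -- Any solution with y'(-S) = 0 is y(-S) times the normalized one; the coefficient 0 makes the
    -- combination a scalar multiple.
    have hQ := (h₁.pair z).linear_combination hS.le hL hR (h₁.pair z) (l (-S)) 0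
    obtain ⟨e1, e2, e3⟩ := hP.eqOn_of_initial hS.le hL hR hQ
      (by simp [h₁.left.initial]) (by rw [← hdyl hmem, hd]; simp [h₁.left.initial_deriv])
    have e4 := e3 (right_mem_Icc.2 hS.le)
    rw [← hdyr hmem', hdS] at e4
    simp only [zero_mul, add_zero] at e4
    rcases mul_eq_zero.1 e4.symm with h0 | h0
    · exfalso
      apply hyx
      rcases lt_or_ge x 0 with hx0 | hx0
      · rw [hyl ⟨hx.1.1, hx0⟩, e1 ⟨hx.1.1, hx0.le⟩, h0]
        simp
      · rw [hyr ⟨lt_of_le_of_ne hx0 (fun h ↦ hx.2 h.symm), hx.1.2⟩, e2 ⟨hx0, hx.1.2⟩, h0]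
        simp
    · exact h0
  · intro h0
    refine ⟨_, _, (h₁.pair z).isTransferSolution, ?_, ?_, -S, ⟨⟨le_rfl, by linarith⟩, ?_⟩, ?_⟩
    · simp [hS, h₁.left.initial_deriv]
    · simp [not_lt.2 hS.le, h0]
    · simp [hS.ne']
    · simp [hS, h₁.left.initial]

theorem isNormingConstant_iff (hS : 0 < S) (hL : IntervalIntegrable q volume (-S) 0)
    (hR : IntervalIntegrable q volume 0 S) (h₁ : IsTransferFamily S q M 1 0 l₁ dl₁ r₁ dr₁)
    {z a : ℂ} : IsNormingConstant S q M z a ↔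
      a = (∫ t in (-S)..0, l₁ z t ^ 2) + ∫ t in 0..S, r₁ z t ^ 2 := by
  have hmem : -S ∈ Ico (-S) 0 := ⟨le_rfl, by linarith⟩
  constructor
  · rintro ⟨y, dy, ⟨l, dl, r, dr, hl, hr, hyl, hdyl, hyr, hdyr, ht, htd⟩, hi, hd, rfl⟩
    have hP : IsTransferPair S q M z l dl r dr := ⟨hl, hr, ht, htd⟩
    obtain ⟨e1, e2, e3⟩ := hP.eqOn_of_initial hS.le hL hR (h₁.pair z)
      (by rw [← hyl hmem, hi, h₁.left.initial]) (by rw [← hdyl hmem, hd, h₁.left.initial_deriv])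
    exact (h₁.pair z).integral_sq hS (hyl.trans (e1.mono Ico_subset_Icc_self))
      (hyr.trans (e2.mono Ioc_subset_Icc_self))
  · rintro rfl
    refine ⟨_, _, (h₁.pair z).isTransferSolution, by simp [hS, h₁.left.initial],
      by simp [hS, h₁.left.initial_deriv], ?_⟩
    exact ((h₁.pair z).integral_sq hS (fun x hx ↦ by simp [hx.2])
      (fun x hx ↦ by simp [hx.1.le])).symm

theorem im_eq_zero_of_deriv_eq_zero (hS : 0 < S) (hL : IntervalIntegrable q volume (-S) 0)
    (hR : IntervalIntegrable q volume 0 S) (hM : M.det = 1)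
    (h₁ : IsTransferFamily S q M 1 0 l₁ dl₁ r₁ dr₁) {z : ℂ} (hz : dr₁ z S = 0) : z.im = 0 := by
  have h := (h₁.pair z).im_deriv_mul_conj hS.le hL hR hM (right_mem_Icc.2 hS.le)
  rw [hz, h₁.left.initial_deriv, zero_mul, zero_mul, Complex.zero_im, zero_sub, zero_eq_neg] at h
  exact (mul_eq_zero.1 h).resolve_right (h₁.integral_norm_sq_pos hS z).ne'

/-- For real z the solution equals its own conjugate by uniqueness, so its square is |w|². -/
theorem IsTransferFamily.integral_sq_ne_zero (hS : 0 < S) (hL : IntervalIntegrable q volume (-S) 0)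
    (hR : IntervalIntegrable q volume 0 S) (h₁ : IsTransferFamily S q M 1 0 l₁ dl₁ r₁ dr₁) {z : ℂ}
    (hz : z.im = 0) : (∫ t in (-S)..0, l₁ z t ^ 2) + ∫ t in 0..S, r₁ z t ^ 2 ≠ 0 := by
  have hstar : star z = z := Complex.conj_eq_iff_im.2 hz
  have hc := (h₁.pair z).conj
  rw [hstar] at hc
  obtain ⟨e1, e2, -⟩ := hc.eqOn_of_initial hS.le hL hR (h₁.pair z)
    (by simp [h₁.left.initial]) (by simp [h₁.left.initial_deriv])
  have key : ∀ w : ℂ, star w = w → w ^ 2 = ((‖w‖ ^ 2 : ℝ) : ℂ) := fun w hw ↦ by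
    rw [← Complex.normSq_eq_norm_sq, ← Complex.mul_conj, ← Complex.star_def, hw, pow_two]
  have i1 : ∫ t in (-S)..0, l₁ z t ^ 2 = ((∫ t in (-S)..0, ‖l₁ z t‖ ^ 2 : ℝ) : ℂ) := by
    rw [← intervalIntegral.integral_ofReal]
    refine intervalIntegral.integral_congr fun t ht ↦ key _ (e1 ?_)
    rwa [uIcc_of_le (by linarith)] at ht
  have i2 : ∫ t in 0..S, r₁ z t ^ 2 = ((∫ t in 0..S, ‖r₁ z t‖ ^ 2 : ℝ) : ℂ) := by
    rw [← intervalIntegral.integral_ofReal]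
    refine intervalIntegral.integral_congr fun t ht ↦ key _ (e2 ?_)
    rwa [uIcc_of_le hS.le] at ht
  rw [i1, i2, ← Complex.ofReal_add, Complex.ofReal_ne_zero]
  exact (h₁.integral_norm_sq_pos hS z).ne'

/-- The residues of the Weyl function are the negative reciprocals of the norming constants. -/
theorem tendsto_sub_mul_weyl (hS : 0 < S) (hL : IntervalIntegrable q volume (-S) 0)
    (hR : IntervalIntegrable q volume 0 S) (hM : M.det = 1)
    (h₁ : IsTransferFamily S q M 1 0 l₁ dl₁ r₁ dr₁)
    (h₂ : IsTransferFamily S q M 0 1 l₂ dl₂ r₂ dr₂) {z₀ : ℂ} (hz₀ : dr₁ z₀ S = 0) {a : ℂ}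
    (ha : IsNormingConstant S q M z₀ a) :
    Tendsto (fun z ↦ (z - z₀) * (dr₂ z S / dr₁ z S)) (𝓝[≠] z₀) (𝓝 (-a⁻¹)) := by
  have him := im_eq_zero_of_deriv_eq_zero hS hL hR hM h₁ hz₀
  have ha' := (isNormingConstant_iff hS hL hR h₁).1 ha
  have ha0 : a ≠ 0 := by
    rw [ha']; exact h₁.integral_sq_ne_zero hS hL hR him
  let J : ℂ → ℂ := fun z ↦ (∫ t in (-S)..0, l₁ z t * l₁ z₀ t) + ∫ t in 0..S, r₁ z t * r₁ z₀ t
  have hJ0 : J z₀ = a := by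
    rw [ha']; simp only [J, pow_two]
  have hJc : Continuous J := by
    have cl := h₁.left.continuous
    have cr := h₁.continuous_right
    have cl0 : Continuous (l₁ z₀) := cl.comp (Continuous.prodMk_right z₀)
    have cr0 : Continuous (r₁ z₀) := cr.comp (Continuous.prodMk_right z₀)
    refine Continuous.add ?_ ?_ <;>
      refine intervalIntegral.continuous_parametric_intervalIntegral_of_continuous' ?_ _ _
    · exact cl.mul (cl0.comp continuous_snd)
    · exact cr.mul (cr0.comp continuous_snd)
  have hW := (h₁.pair z₀).wronskian hS.le hL hR hM (h₂.pair z₀)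
  rw [h₁.left.initial, h₁.left.initial_deriv, h₂.left.initial, h₂.left.initial_deriv, hz₀] at hW
  have hρ : r₁ z₀ S * dr₂ z₀ S = 1 := by linear_combination hW
  have hρ0 : r₁ z₀ S ≠ 0 := left_ne_zero_of_mul_eq_one hρ
  -- Lagrange's identity between z and z₀ factors φ'(S, z) with J(z₀) = a ≠ 0, so the zero at z₀ is
  -- simple. The residue follows from φθ' = 1 at (S, z₀).
  have hΔ : ∀ z, dr₁ z S = -((z - z₀) * J z) / r₁ z₀ S := fun z ↦ by
    have h := (h₁.pair z).wronskian hS.le hL hR hM (h₁.pair z₀)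
    rw [h₁.left.initial, h₁.left.initial_deriv, h₁.left.initial, h₁.left.initial_deriv, hz₀] at h
    rw [eq_div_iff hρ0]
    simp only [J]
    linear_combination -h
  have hlim : Tendsto (fun z ↦ -(r₁ z₀ S * dr₂ z S) / J z) (𝓝[≠] z₀) (𝓝 (-a⁻¹)) := by
    have hd2 := h₂.differentiable_deriv.continuous
    have hc : ContinuousAt (fun z ↦ -(r₁ z₀ S * dr₂ z S) / J z) z₀ :=
      (by fun_prop : ContinuousAt (fun z ↦ -(r₁ z₀ S * dr₂ z S)) z₀).div hJc.continuousAt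
        (by rwa [hJ0])
    have h := hc.tendsto
    rw [hρ, hJ0, neg_div, one_div] at h
    exact h.mono_left nhdsWithin_le_nhds
  refine hlim.congr' ?_
  filter_upwards [self_mem_nhdsWithin] with z hz
  have hz' : z - z₀ ≠ 0 := sub_ne_zero.2 hz
  rw [hΔ]
  rcases eq_or_ne (J z) 0 with h0 | h0
  · simp [h0]
  · field_simp

/-- The Weyl solution: the solution of the transfer problem with `ψ'(-S) = -1`, `ψ'(S) = 0`. -/
theorem weyl_pair (hS : 0 < S) (hL : IntervalIntegrable q volume (-S) 0)
    (hR : IntervalIntegrable q volume 0 S) (hM : M.det = 1)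
    (h₁ : IsTransferFamily S q M 1 0 l₁ dl₁ r₁ dr₁)
    (h₂ : IsTransferFamily S q M 0 1 l₂ dl₂ r₂ dr₂) {z : ℂ} (hz : z.im ≠ 0) :
    ∃ r dr : ℝ → ℂ, IsTransferPair S q M z
      (fun x ↦ dr₂ z S / dr₁ z S * l₁ z x - l₂ z x)
      (fun x ↦ dr₂ z S / dr₁ z S * dl₁ z x - dl₂ z x) r dr ∧ dr S = 0 := by
  have h0 : dr₁ z S ≠ 0 := fun h ↦ hz (im_eq_zero_of_deriv_eq_zero hS hL hR hM h₁ h)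
  have h := (h₁.pair z).linear_combination hS.le hL hR (h₂.pair z) (dr₂ z S / dr₁ z S) (-1)
  simp only [neg_mul, one_mul, ← sub_eq_add_neg] at h
  exact ⟨_, _, h, by simp [h0]⟩

theorem IsTransferPair.im_weyl (hS : 0 < S) (hL : IntervalIntegrable q volume (-S) 0)
    (hR : IntervalIntegrable q volume 0 S) (hM : M.det = 1) {z m : ℂ} {l dl r dr : ℝ → ℂ}
    (h : IsTransferPair S q M z l dl r dr) (hl : l (-S) = m) (hdl : dl (-S) = -1)
    (hdr : dr S = 0) :
    m.im = z.im * ((∫ t in (-S)..0, ‖l t‖ ^ 2) + ∫ t in 0..S, ‖r t‖ ^ 2) := by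
  have e := h.im_deriv_mul_conj hS.le hL hR hM (right_mem_Icc.2 hS.le)
  rw [hdr, hl, hdl] at e
  simp at e
  linarith

theorem norm_integral_mul_le {a b : ℝ} (hab : a ≤ b) {f g : ℝ → ℂ} (hf : ContinuousOn f (Icc a b))
    (hg : ContinuousOn g (Icc a b)) {ε : ℝ} (hε : 0 < ε) :
    ‖∫ t in a..b, f t * g t‖ ≤
      (ε * (∫ t in a..b, ‖f t‖ ^ 2) + ε⁻¹ * ∫ t in a..b, ‖g t‖ ^ 2) / 2 := by
  have if2 : IntervalIntegrable (fun t ↦ ‖f t‖ ^ 2) volume a b :=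
    ContinuousOn.intervalIntegrable (by rw [uIcc_of_le hab]; exact hf.norm.pow 2)
  have ig2 : IntervalIntegrable (fun t ↦ ‖g t‖ ^ 2) volume a b :=
    ContinuousOn.intervalIntegrable (by rw [uIcc_of_le hab]; exact hg.norm.pow 2)
  calc _ ≤ ∫ t in a..b, (ε * ‖f t‖ ^ 2 + ε⁻¹ * ‖g t‖ ^ 2) / 2 := by
        refine intervalIntegral.norm_integral_le_of_norm_le hab
          (Eventually.of_forall fun t _ ↦ ?_)
          (((if2.const_mul ε).add (ig2.const_mul ε⁻¹)).div_const 2)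
        rw [norm_mul]
        have h := mul_nonneg (inv_pos.2 hε).le (sq_nonneg (ε * ‖f t‖ - ‖g t‖))
        have e : ε⁻¹ * (ε * ‖f t‖ - ‖g t‖) ^ 2 =
            ε * ‖f t‖ ^ 2 + ε⁻¹ * ‖g t‖ ^ 2 - 2 * (‖f t‖ * ‖g t‖) := by
          field_simp
          ring
        linarith
    _ = _ := by
        rw [intervalIntegral.integral_div, intervalIntegral.integral_add (if2.const_mul ε)
          (ig2.const_mul ε⁻¹), intervalIntegral.integral_const_mul,
          intervalIntegral.integral_const_mul]

/-- Comparison with z = i: Lagrange's identity gives m - m₀ = (z - i)J with J = ∫ψψ₀. The bound ‖ψ‖²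
≤ |m|/|Im z| and the weight ε = |Im z|/(1 + |z|) in Cauchy–Schwarz leave |m|/2 on the right, which
is absorbed. -/
theorem exists_norm_weyl_mul_im_le (hS : 0 < S) (hL : IntervalIntegrable q volume (-S) 0)
    (hR : IntervalIntegrable q volume 0 S) (hM : M.det = 1)
    (h₁ : IsTransferFamily S q M 1 0 l₁ dl₁ r₁ dr₁)
    (h₂ : IsTransferFamily S q M 0 1 l₂ dl₂ r₂ dr₂) :
    ∃ K, ∀ z : ℂ, z.im ≠ 0 → ‖dr₂ z S / dr₁ z S‖ * |z.im| ≤ K * (1 + ‖z‖) ^ 2 := by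
  obtain ⟨ρ, dρ, hp, hρ⟩ := weyl_pair hS hL hR hM h₁ h₂ (z := Complex.I) (by simp)
  set m₀ := dr₂ Complex.I S / dr₁ Complex.I S with hm₀
  set N₁ := ∫ t in (-S)..0, ‖m₀ * l₁ Complex.I t - l₂ Complex.I t‖ ^ 2 with hN₁
  set N₂ := ∫ t in 0..S, ‖ρ t‖ ^ 2 with hN₂
  have hN₁0 : 0 ≤ N₁ := intervalIntegral.integral_nonneg (by linarith) fun t _ ↦ by positivity
  have hN₂0 : 0 ≤ N₂ := intervalIntegral.integral_nonneg hS.le fun t _ ↦ by positivity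
  refine ⟨2 * ‖m₀‖ + (N₁ + N₂), fun z hz ↦ ?_⟩
  obtain ⟨r, dr, hr, hdr⟩ := weyl_pair hS hL hR hM h₁ h₂ hz
  set m := dr₂ z S / dr₁ z S with hm
  have y0 : 0 < |z.im| := abs_pos.2 hz
  set ε : ℝ := |z.im| / (1 + ‖z‖) with hε
  have hε0 : 0 < ε := by positivity
  have hW := hr.wronskian hS.le hL hR hM hp
  rw [hdr, hρ] at hW
  simp only [h₁.left.initial, h₁.left.initial_deriv, h₂.left.initial, h₂.left.initial_deriv] at hW
  have e1 := norm_integral_mul_le (by linarith) hr.left.continuousOn hp.left.continuousOn hε0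
  have e2 := norm_integral_mul_le hS.le hr.right.continuousOn hp.right.continuousOn hε0
  have him := hr.im_weyl hS hL hR hM (m := m) (by simp [h₁.left.initial, h₂.left.initial])
    (by simp [h₁.left.initial_deriv, h₂.left.initial_deriv]) hdr
  rw [← hN₁] at e1
  rw [← hN₂] at e2
  set P₁ := ∫ t in (-S)..0, ‖m * l₁ z t - l₂ z t‖ ^ 2 with hP₁
  set P₂ := ∫ t in 0..S, ‖r t‖ ^ 2 with hP₂
  set J := (∫ t in (-S)..0, (m * l₁ z t - l₂ z t) * (m₀ * l₁ Complex.I t - l₂ Complex.I t)) +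
    ∫ t in 0..S, r t * ρ t with hJ
  have hP0 : 0 ≤ P₁ + P₂ := add_nonneg
    (intervalIntegral.integral_nonneg (by linarith) fun t _ ↦ by positivity)
    (intervalIntegral.integral_nonneg hS.le fun t _ ↦ by positivity)
  have hP : |z.im| * (P₁ + P₂) ≤ ‖m‖ := by
    rw [← abs_of_nonneg hP0, ← abs_mul, ← him]
    exact Complex.abs_im_le_norm m
  have hJle : ‖J‖ ≤ (ε * (P₁ + P₂) + ε⁻¹ * (N₁ + N₂)) / 2 := by
    refine (norm_add_le _ _).trans ((add_le_add e1 e2).trans_eq ?_)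
    ring
  have hdiff : m = m₀ + (z - Complex.I) * J := by linear_combination hW
  have hzI : ‖z - Complex.I‖ ≤ 1 + ‖z‖ := by
    have := norm_sub_le z Complex.I
    rw [Complex.norm_I] at this
    linarith
  have hmle : ‖m‖ ≤ ‖m₀‖ + (1 + ‖z‖) * ((ε * (P₁ + P₂) + ε⁻¹ * (N₁ + N₂)) / 2) := by
    conv_lhs => rw [hdiff]
    refine (norm_add_le _ _).trans ?_
    rw [norm_mul]
    gcongr
  have t1 : (1 + ‖z‖) * (ε * (P₁ + P₂)) = |z.im| * (P₁ + P₂) := by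
    rw [hε]; field_simp
  have t2 : (1 + ‖z‖) * (ε⁻¹ * (N₁ + N₂)) * |z.im| = (1 + ‖z‖) ^ 2 * (N₁ + N₂) := by
    rw [hε]; field_simp
  have h3 : ‖m‖ ≤ 2 * ‖m₀‖ + (1 + ‖z‖) * (ε⁻¹ * (N₁ + N₂)) := by linarith
  have h4 := mul_le_mul_of_nonneg_right h3 y0.le
  have h5 : |z.im| ≤ (1 + ‖z‖) ^ 2 := by
    have := Complex.abs_im_le_norm z
    nlinarith [norm_nonneg z]
  rw [add_mul, t2] at h4
  have h6 : 2 * ‖m₀‖ * |z.im| ≤ 2 * ‖m₀‖ * (1 + ‖z‖) ^ 2 := by gcongr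
  linarith

/-- The quantity is (Im z)² times the mass of the Weyl solution lying to the right of x. -/
theorem weyl_sign_left (hS : 0 < S) (hL : IntervalIntegrable q volume (-S) 0)
    (hR : IntervalIntegrable q volume 0 S) (hM : M.det = 1) {z m : ℂ} {l dl r dr : ℝ → ℂ}
    (h : IsTransferPair S q M z l dl r dr) (hl : l (-S) = m) (hdl : dl (-S) = -1)
    (hdr : dr S = 0) {x : ℝ} (hx : x ∈ Icc (-S) 0) :
    0 ≤ z.im * (dl x * star (l x)).im := by
  have e := h.left.im_deriv_mul_conj (by linarith) hL hx
  have e' := h.im_weyl hS hL hR hM hl hdl hdr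
  rw [hl, hdl] at e
  simp only [neg_mul, one_mul, Complex.neg_im, Complex.star_def, Complex.conj_im, neg_neg] at e
  have hle : ∫ t in (-S)..x, ‖l t‖ ^ 2 ≤ ∫ t in (-S)..0, ‖l t‖ ^ 2 :=
    intervalIntegral.integral_mono_interval le_rfl hx.1 hx.2
      (Eventually.of_forall fun t ↦ by positivity)
      (ContinuousOn.intervalIntegrable (by
        rw [uIcc_of_le (by linarith)]; exact h.left.continuousOn.norm.pow 2))
  have hr0 : 0 ≤ ∫ t in 0..S, ‖r t‖ ^ 2 :=
    intervalIntegral.integral_nonneg hS.le fun t _ ↦ by positivity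
  simp only [Complex.star_def]
  rw [e, e']
  have : 0 ≤ z.im ^ 2 * ((∫ t in (-S)..0, ‖l t‖ ^ 2) + (∫ t in 0..S, ‖r t‖ ^ 2) -
    ∫ t in (-S)..x, ‖l t‖ ^ 2) := mul_nonneg (sq_nonneg _) (by linarith)
  linarith

theorem im_deriv_mul_conj_of_neumann_right (hS : 0 ≤ S) (hR : IntervalIntegrable q volume 0 S)
    {z : ℂ} {r dr : ℝ → ℂ} (h : IsSolutionOn q z 0 S r dr) (hdr : dr S = 0) {x : ℝ}
    (hx : x ∈ Icc 0 S) : (dr x * star (r x)).im = z.im * ∫ t in x..S, ‖r t‖ ^ 2 := by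
  have e := h.im_deriv_mul_conj hS hR hx
  have e' := h.im_deriv_mul_conj hS hR (right_mem_Icc.2 hS)
  have hi : ∀ u ∈ Icc 0 S, IntervalIntegrable (fun t ↦ ‖r t‖ ^ 2) volume 0 u := fun u hu ↦
    ContinuousOn.intervalIntegrable (by
      rw [uIcc_of_le hu.1]
      exact (h.continuousOn.mono (Icc_subset_Icc_right hu.2)).norm.pow 2)
  have hs := intervalIntegral.integral_interval_sub_left (hi S (right_mem_Icc.2 hS)) (hi x hx)
  rw [hdr, zero_mul, Complex.zero_im] at e'
  rw [← hs, e]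
  linarith

theorem deriv_ne_zero_of_neumann_right (hS : 0 < S) (hR : IntervalIntegrable q volume 0 S)
    {z : ℂ} (hz : z.im ≠ 0) {r dr : ℝ → ℂ} (h : IsSolutionOn q z 0 S r dr) (hdr : dr S = 0)
    (hr : r 0 ≠ 0) : dr 0 ≠ 0 := by
  intro h0
  have e := im_deriv_mul_conj_of_neumann_right hS.le hR h hdr (left_mem_Icc.2 hS.le)
  rw [h0, zero_mul, Complex.zero_im] at e
  have hpos : 0 < ∫ t in 0..S, ‖r t‖ ^ 2 :=
    intervalIntegral.integral_pos hS (h.continuousOn.norm.pow 2) (fun t _ ↦ by positivity)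
      ⟨0, left_mem_Icc.2 hS.le, by positivity⟩
  exact mul_ne_zero hz hpos.ne' e.symm

/-- Makes the right-hand Weyl function well defined. If both data at 0⁺ vanish, invertibility of M
and the Wronskian with c propagate this back to l'(-S) = 0; if only the derivative does, z is a
non-real Neumann eigenvalue of [0, S]. -/
theorem IsTransferPair.deriv_right_ne_zero (hS : 0 < S) (hL : IntervalIntegrable q volume (-S) 0)
    (hR : IntervalIntegrable q volume 0 S) (hM : M.det = 1) {z : ℂ} (hz : z.im ≠ 0)
    {l dl r dr : ℝ → ℂ} (h : IsTransferPair S q M z l dl r dr) (hdl : dl (-S) ≠ 0)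
    (hdr : dr S = 0) : dr 0 ≠ 0 := by
  by_cases hr : r 0 = 0
  · intro h0
    have hdet := det_ofReal hM
    have t1 := h.transfer
    have t2 := h.transfer_deriv
    rw [hr] at t1
    rw [h0] at t2
    have hl0 : l 0 = 0 := by
      linear_combination (-l 0) * hdet - M 1 1 * t1 + M 0 1 * t2
    have hdl0 : dl 0 = 0 := by
      linear_combination (-dl 0) * hdet + M 1 0 * t1 - M 0 0 * t2
    obtain ⟨c, dc, hc⟩ := exists_isAnalyticSolution (q := q) (by linarith : -S ≤ 0) hL 1 0
    have hW := h.left.wronskian (by linarith) hL (hc.isSolutionOn z) (x := 0) ⟨by linarith, le_rfl⟩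
    rw [hl0, hdl0, hc.initial, hc.initial_deriv] at hW
    apply hdl
    linear_combination hW
  · exact deriv_ne_zero_of_neumann_right hS hR hz h.right hdr hr

theorem weyl_sign_right (hS : 0 < S) (hR : IntervalIntegrable q volume 0 S) {z : ℂ}
    {r dr : ℝ → ℂ} (h : IsSolutionOn q z 0 S r dr) (hdr : dr S = 0) (hdr0 : dr 0 ≠ 0)
    {c dc s ds : ℂ → ℝ → ℂ} (hc : IsAnalyticSolution q 0 S 1 0 c dc)
    (hs : IsAnalyticSolution q 0 S 0 1 s ds) {x : ℝ} (hx : x ∈ Icc 0 S) :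
    0 ≤ z.im * ((-(r 0 / dr 0) * dc z x - ds z x) *
      star (-(r 0 / dr 0) * c z x - s z x)).im := by
  have h' := (hc.isSolutionOn z).linear_combination hS.le hR (hs.isSolutionOn z) (-(r 0 / dr 0)) (-1)
  -- Rescaling by -1/r'(0) gives the data of mc - s at 0, with m = -r(0)/r'(0).
  have hr' := h.linear_combination hS.le hR h (-(dr 0)⁻¹) 0
  obtain ⟨e1, e2⟩ := hr'.eqOn_of_initial hS.le hR h'
    (by simp [hc.initial, hs.initial]; ring)
    (by simp [hc.initial_deriv, hs.initial_deriv, hdr0])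
  have hs' := im_deriv_mul_conj_of_neumann_right hS.le hR h'
    ((e2 (right_mem_Icc.2 hS.le)).symm.trans (by simp [hdr])) hx
  simp only [neg_mul, one_mul, ← sub_eq_add_neg] at hs' ⊢
  rw [hs', ← mul_assoc]
  exact mul_nonneg (mul_self_nonneg _)
    (intervalIntegral.integral_nonneg hx.2 fun t _ ↦ by positivity)

end WeylFunction

end TransferSL

/-! ### The uniqueness theorem -/

open TransferSL

theorem corollary4p5 (S : ℝ) (hS : 0 < S)
    (M : Matrix (Fin 2) (Fin 2) ℝ) (hM : M.det = 1)
    (q₁ q₂ : ℝ → ℝ)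
    (hq₁ : MemLp q₁ 2 (volume.restrict (Icc (-S) S)))
    (hq₂ : MemLp q₂ 2 (volume.restrict (Icc (-S) S)))
    (hspec : TransferSL.neumannSpectrum S q₁ M = TransferSL.neumannSpectrum S q₂ M)
    (hnorm : ∀ z ∈ TransferSL.neumannSpectrum S q₁ M, ∀ a : ℂ,
      TransferSL.IsNormingConstant S q₁ M z a ↔ TransferSL.IsNormingConstant S q₂ M z a) :
    q₁ =ᵐ[volume.restrict (Icc (-S) S)] q₂ := by
  have hint : ∀ {q : ℝ → ℝ}, MemLp q 2 (volume.restrict (Icc (-S) S)) →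
      IntervalIntegrable q volume (-S) 0 ∧ IntervalIntegrable q volume 0 S := by
    intro q hq
    have h : IntegrableOn q (Icc (-S) S) volume := hq.integrable one_le_two
    exact ⟨(intervalIntegrable_iff_integrableOn_Icc_of_le (by linarith)).2
      (h.mono_set (Icc_subset_Icc_right hS.le)),
      (intervalIntegrable_iff_integrableOn_Icc_of_le hS.le).2
      (h.mono_set (Icc_subset_Icc_left (by linarith)))⟩
  obtain ⟨hL₁, hR₁⟩ := hint hq₁
  obtain ⟨hL₂, hR₂⟩ := hint hq₂
  have hS0 : -S < 0 := by linarith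
  obtain ⟨c₁, dc₁, hc₁⟩ := exists_isAnalyticSolution hS0.le hL₁ 1 0
  obtain ⟨s₁, ds₁, hs₁⟩ := exists_isAnalyticSolution hS0.le hL₁ 0 1
  obtain ⟨c₂, dc₂, hc₂⟩ := exists_isAnalyticSolution hS0.le hL₂ 1 0
  obtain ⟨s₂, ds₂, hs₂⟩ := exists_isAnalyticSolution hS0.le hL₂ 0 1
  obtain ⟨C₁, dC₁, hC₁⟩ := exists_isAnalyticSolution hS.le hR₁ 1 0
  obtain ⟨T₁, dT₁, hT₁⟩ := exists_isAnalyticSolution hS.le hR₁ 0 1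
  obtain ⟨C₂, dC₂, hC₂⟩ := exists_isAnalyticSolution hS.le hR₂ 1 0
  obtain ⟨T₂, dT₂, hT₂⟩ := exists_isAnalyticSolution hS.le hR₂ 0 1
  obtain ⟨cr₁, dcr₁, hw₁⟩ := hc₁.exists_isTransferFamily hS.le hR₁ M
  obtain ⟨sr₁, dsr₁, hu₁⟩ := hs₁.exists_isTransferFamily hS.le hR₁ M
  obtain ⟨cr₂, dcr₂, hw₂⟩ := hc₂.exists_isTransferFamily hS.le hR₂ M
  obtain ⟨sr₂, dsr₂, hu₂⟩ := hs₂.exists_isTransferFamily hS.le hR₂ M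
  set m₁ : ℂ → ℂ := fun z ↦ dsr₁ z S / dcr₁ z S with hm₁
  set m₂ : ℂ → ℂ := fun z ↦ dsr₂ z S / dcr₂ z S with hm₂
  have hsp₁ : ∀ z, z ∈ neumannSpectrum S q₁ M ↔ dcr₁ z S = 0 := fun z ↦
    mem_neumannSpectrum_iff hS hL₁ hR₁ hw₁
  have hsp₂ : ∀ z, z ∈ neumannSpectrum S q₁ M ↔ dcr₂ z S = 0 := fun z ↦
    hspec ▸ mem_neumannSpectrum_iff hS hL₂ hR₂ hw₂
  have hreal : ∀ z, z ∈ neumannSpectrum S q₁ M → z.im = 0 := fun z hz ↦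
    im_eq_zero_of_deriv_eq_zero hS hL₁ hR₁ hM hw₁ ((hsp₁ z).1 hz)
  have an : ∀ {u v : ℂ → ℂ}, Differentiable ℂ u → Differentiable ℂ v → ∀ z, v z ≠ 0 →
      AnalyticAt ℂ (fun z ↦ u z / v z) z := fun hu hv z hz ↦
    (hu.analyticAt z).div (hv.analyticAt z) hz
  have han₁ : ∀ z, z ∉ neumannSpectrum S q₁ M → AnalyticAt ℂ m₁ z := fun z hz ↦
    an hu₁.differentiable_deriv hw₁.differentiable_deriv z fun h ↦ hz ((hsp₁ z).2 h)
  have han₂ : ∀ z, z ∉ neumannSpectrum S q₁ M → AnalyticAt ℂ m₂ z := fun z hz ↦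
    an hu₂.differentiable_deriv hw₂.differentiable_deriv z fun h ↦ hz ((hsp₂ z).2 h)
  -- At a common eigenvalue the residues -1/a cancel; elsewhere both Weyl functions are analytic.
  obtain ⟨h, hh, hext⟩ := exists_differentiable_extension (h₀ := m₁ - m₂)
    (fun z ↦ ((hu₁.differentiable_deriv.analyticAt z).meromorphicAt.div
      (hw₁.differentiable_deriv.analyticAt z).meromorphicAt).sub
      ((hu₂.differentiable_deriv.analyticAt z).meromorphicAt.div
      (hw₂.differentiable_deriv.analyticAt z).meromorphicAt)) (fun z ↦ by
    by_cases hz : z ∈ neumannSpectrum S q₁ M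
    · have ha := (isNormingConstant_iff (z := z) hS hL₁ hR₁ hw₁).2 rfl
      have k₁ := tendsto_sub_mul_weyl hS hL₁ hR₁ hM hw₁ hu₁ ((hsp₁ z).1 hz) ha
      have k₂ := tendsto_sub_mul_weyl hS hL₂ hR₂ hM hw₂ hu₂ ((hsp₂ z).1 hz) ((hnorm z hz _).1 ha)
      have k := k₁.sub k₂
      rw [sub_self] at k
      simpa only [← mul_sub] using! k
    · have hcont : ContinuousAt (fun w ↦ (w - z) * (m₁ - m₂) w) z :=
        (by fun_prop : ContinuousAt (fun w ↦ w - z) z).mul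
          ((han₁ z hz).sub (han₂ z hz)).continuousAt
      have k := hcont.tendsto
      rw [sub_self, zero_mul] at k
      exact k.mono_left nhdsWithin_le_nhds)
  have hm : ∀ z : ℂ, z.im ≠ 0 → m₁ z - m₂ z = h z := fun z hz ↦
    (hext z ((han₁ z fun h ↦ hz (hreal z h)).sub (han₂ z fun h ↦ hz (hreal z h)))).symm
  obtain ⟨K₁, hK₁⟩ := exists_norm_weyl_mul_im_le hS hL₁ hR₁ hM hw₁ hu₁
  obtain ⟨K₂, hK₂⟩ := exists_norm_weyl_mul_im_le hS hL₂ hR₂ hM hw₂ hu₂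
  have hK0 : ∀ {K : ℝ} {m : ℂ → ℂ}, (∀ z : ℂ, z.im ≠ 0 → ‖m z‖ * |z.im| ≤ K * (1 + ‖z‖) ^ 2) →
      0 ≤ K := fun {K m} hK ↦ by
    have h1 := hK Complex.I (by simp)
    have h2 : 0 ≤ K * (1 + ‖Complex.I‖) ^ 2 := le_trans (by positivity) h1
    exact nonneg_of_mul_nonneg_left h2 (by positivity)
  have hK₁0 := hK0 hK₁
  have hK₂0 := hK0 hK₂
  obtain ⟨C, hC⟩ := exists_norm_le_mul_norm hh (C := K₁ + K₂) (fun z ↦ by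
    by_cases hz : z.im = 0
    · rw [hz, abs_zero, mul_zero]; positivity
    · rw [← hm z hz]
      calc _ ≤ (‖m₁ z‖ + ‖m₂ z‖) * |z.im| := by gcongr; exact norm_sub_le _ _
        _ ≤ _ := by
          have k1 := hK₁ z hz
          have k2 := hK₂ z hz
          simp only [hm₁, hm₂]
          linarith)
  obtain ⟨hmeq, heq, hleft⟩ := borg_marchenko hS0 hL₁ hL₂ hc₁ hs₁ hc₂ hs₂ hh hC hm
    (fun z hz x hx ↦ by
      obtain ⟨r, dr, hr, hdr⟩ := weyl_pair hS hL₁ hR₁ hM hw₁ hu₁ hz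
      exact weyl_sign_left hS hL₁ hR₁ hM hr rfl
        (by simp [hc₁.initial_deriv, hs₁.initial_deriv]) hdr hx)
    (fun z hz x hx ↦ by
      obtain ⟨r, dr, hr, hdr⟩ := weyl_pair hS hL₂ hR₂ hM hw₂ hu₂ hz
      exact weyl_sign_left hS hL₂ hR₂ hM hr rfl
        (by simp [hc₂.initial_deriv, hs₂.initial_deriv]) hdr hx)
  -- A and B are ψ(0⁺) and ψ'(0⁺). Though written with the first potential, they serve both
  -- problems, since the left-hand step identifies m, c and s.
  let A : ℂ → ℂ := fun z ↦ M 0 0 * (m₁ z * c₁ z 0 - s₁ z 0) + M 0 1 * (m₁ z * dc₁ z 0 - ds₁ z 0)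
  let B : ℂ → ℂ := fun z ↦ M 1 0 * (m₁ z * c₁ z 0 - s₁ z 0) + M 1 1 * (m₁ z * dc₁ z 0 - ds₁ z 0)
  have h0 : (0 : ℝ) ∈ Icc (-S) 0 := ⟨hS0.le, le_rfl⟩
  obtain ⟨-, -, hright⟩ := borg_marchenko (m₁ := fun z ↦ -(A z / B z)) (m₂ := fun z ↦ -(A z / B z))
    (h := fun _ ↦ 0) (C := 0) hS hR₁ hR₂ hC₁ hT₁ hC₂ hT₂ (differentiable_const 0)
    (fun z _ ↦ by simp) (fun z _ ↦ by simp)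
    (fun z hz x hx ↦ by
      obtain ⟨r, dr, hr, hdr⟩ := weyl_pair hS hL₁ hR₁ hM hw₁ hu₁ hz
      have hB : dr 0 = B z := hr.transfer_deriv
      have hA : r 0 = A z := hr.transfer
      rw [← hA, ← hB]
      exact weyl_sign_right hS hR₁ hr.right hdr (hr.deriv_right_ne_zero hS hL₁ hR₁ hM hz
        (by simp [hc₁.initial_deriv, hs₁.initial_deriv]) hdr) hC₁ hT₁ hx)
    (fun z hz x hx ↦ by
      obtain ⟨r, dr, hr, hdr⟩ := weyl_pair hS hL₂ hR₂ hM hw₂ hu₂ hz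
      obtain ⟨k1, k2, k3, k4⟩ := heq z hz 0 h0
      have hB : dr 0 = B z := by
        simp only [B, hmeq z hz, k1, k2, k3, k4]
        exact hr.transfer_deriv
      have hA : r 0 = A z := by
        simp only [A, hmeq z hz, k1, k2, k3, k4]
        exact hr.transfer
      rw [← hA, ← hB]
      exact weyl_sign_right hS hR₂ hr.right hdr (hr.deriv_right_ne_zero hS hL₂ hR₂ hM hz
        (by simp [hc₂.initial_deriv, hs₂.initial_deriv]) hdr) hC₂ hT₂ hx)
  rw [← Icc_union_Icc_eq_Icc hS0.le hS.le]
  exact ae_restrict_union_iff _ _ _ |>.2 ⟨hleft, hright⟩
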